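/- Let $R$ be the root system of type $E_6$ with simple roots $\alpha_1,\dots,\alpha_6$ (Bourbaki numbering), simple reflections $s_1,\dots,s_6$, Weyl group $W$, and highest root $\tilde\alpha$. Consider the root datum $(X^*,X_*,R,R^\vee)$ with $X^*=Q(R)$ the root lattice and $X_*=P(R^\vee)$ the coweight lattice, and let $\rho_1,\dots,\rho_6\in X_*$ be the fundamental coweights, i.e. the basis dual to $\alpha_1,\dots,\alpha_6$. Put $V=X_*\otimes\mathbb R$, $W_a=Q(R^\vee)\rtimes W$ and $\widetilde W=X_*\rtimes W$, acting on $V$ by affine transformations; $t_\nu\in\widetilde W$ denotes translation by $\nu\in X_*$. Let $\mathfrak A=\{v\in V: \langle\alpha_i,v\rangle>0 \text{ for } i=1,\dots,6,\ \langle\tilde\alpha,v\rangle<1\}$ be the base alcove and $\Omega\subset\widetilde W$ its stabilizer, so that $\widetilde W=W_a\rtimes\Omega$. The Bruhat order on the Coxeter group $W_a$ (whose simple reflections are the reflections in the walls of $\mathfrak A$) is extended to $\widetilde W$ by: $y\omega\le y'\omega'$ if and only if $\omega=\omega'$ and $y\le y'$, for $y,y'\in W_a$ and $\omega,\omega'\in\Omega$.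 For $\mu\in X_*$ let $\mathrm{Adm}(\mu)$ be the set of all $x\in\widetilde W$ with $x\le t_{w(\mu)}$ for some $w\in W$. Let $\mathrm{Perm}(\mu)$ be the set of all $x\in\widetilde W$ such that $x$ and $t_\mu$ have the same component in $\Omega$ and $x(v)-v$ lies in the convex hull of the orbit $W\mu$ for every $v\in\overline{\mathfrak A}$. Call $\mu$ minuscule if $\langle\alpha,\mu\rangle\in\{-1,0,1\}$ for all $\alpha\in R$, and dominant if $\langle\alpha_i,\mu\rangle\ge 0$ for $i=1,\dots,6$. Then: 1. For $\mu=\rho_1$, $w_1=s_2s_4s_5s_6s_3s_4s_5s_2s_4s_3s_1$ and $w_2=s_4s_5s_6s_2s_4s_5$, the element $x=w_2t_\mu w_1^{-1}\in\widetilde W$ satisfies $x\in\mathrm{Perm}(\mu)$ and $x\notin\mathrm{Adm}(\mu)$. 2. Hence $\mathrm{Adm}(\rho_1)\ne\mathrm{Perm}(\rho_1)$, and also $\mathrm{Adm}(\rho_6)\ne\mathrm{Perm}(\rho_6)$. 3. The nonzero dominant minuscule coweights are exactly $\rho_1$ and $\rho_6$, and $\mathrm{Adm}(\mu)\ne\mathrm{Perm}(\mu)$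 for every nonzero minuscule coweight $\mu\in X_*$. -/

import Mathlib

noncomputable section

open scoped TensorProduct

/-! ### Bruhat order of a group with respect to a set of simple reflections -/

namespace Bruhat

variable {G : Type*} [Group G] (S : Set G)

/-- The length of `g`: the least number of factors in a word in `S` with product `g`
(used only for elements that are products of elements of `S`, where `S` consists of
involutions). -/
def length (g : G) : ℕ :=
  sInf {n : ℕ | ∃ l : List G, (∀ s ∈ l, s ∈ S) ∧ l.prod = g ∧ l.length = n}

/-- The reflections: all conjugates of the simple reflections. -/
def reflections : Set G := {t | ∃ g : G, ∃ s ∈ S, t = g * s * g⁻¹}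

/-- The Bruhat order: the reflexive transitive closure of `u < u * t`, for `t` a reflection
with `length u < length (u * t)`. -/
def le (u v : G) : Prop :=
  Relation.ReflTransGen
    (fun a b => ∃ t ∈ reflections S, b = a * t ∧ length S a < length S b) u v

end Bruhat

/-! ### Extended affine Weyl group, admissible and permissible sets of a root datum -/

namespace RootDatum

variable {ι X Y : Type*} [AddCommGroup X] [AddCommGroup Y] (P : RootDatum ι X Y)

/-- The finite Weyl group, acting on the cocharacter lattice `Y = X_*`. -/
def W : Subgroup (Y ≃ₗ[ℤ] Y) := Subgroup.closure (Set.range P.coreflection)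

/-- The reflection of the root with index `i`, as an element of the finite Weyl group. -/
def refl (i : ι) : W P := ⟨P.coreflection i, Subgroup.subset_closure (Set.mem_range_self i)⟩

/-- The action of the finite Weyl group on the cocharacter lattice, written multiplicatively. -/
def actHom : W P →* MulAut (Multiplicative Y) where
  toFun w := AddEquiv.toMultiplicative (w : Y ≃ₗ[ℤ] Y).toAddEquiv
  map_one' := rfl
  map_mul' _ _ := rfl

/-- The extended affine Weyl group `X_* ⋊ W`. -/
abbrev ExtAffineWeyl : Type _ := Multiplicative Y ⋊[actHom P] W P

/-- The translation element `t_ν`. -/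
def t (ν : Y) : ExtAffineWeyl P := SemidirectProduct.inl (Multiplicative.ofAdd ν)

/-- The inclusion of the finite Weyl group in the extended affine Weyl group. -/
def fin : W P →* ExtAffineWeyl P := SemidirectProduct.inr

/-- The coroot lattice `Q(R^∨) = ℤR^∨`. -/
def corootLattice : AddSubgroup Y := AddSubgroup.closure (Set.range P.coroot)

theorem smul_mem_corootLattice (w : W P) {q : Y} (hq : q ∈ corootLattice P) :
    (w : Y ≃ₗ[ℤ] Y) q ∈ corootLattice P := by
  obtain ⟨w, hw⟩ := w
  have key : ∀ i, ∀ q ∈ corootLattice P, P.coreflection i q ∈ corootLattice P := by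
    intro i q hq
    rw [RootPairing.coreflection_apply]
    exact sub_mem hq (zsmul_mem (AddSubgroup.subset_closure (Set.mem_range_self i)) _)
  change w q ∈ corootLattice P
  induction hw using Subgroup.closure_induction'' generalizing q with
  | mem w hw =>
    obtain ⟨i, rfl⟩ := hw
    exact key i q hq
  | inv_mem w hw =>
    obtain ⟨i, rfl⟩ := hw
    have : (P.coreflection i)⁻¹ = P.coreflection i := P.coreflection_inv i
    rw [this]
    exact key i q hq
  | one => exact hq
  | mul a b _ _ ha hb => exact ha (hb hq)

/-- The affine Weyl group `W_a = Q(R^∨) ⋊ W`, as a subgroup of `X_* ⋊ W`. -/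
def affineWeyl : Subgroup (ExtAffineWeyl P) where
  carrier := {x | x.left.toAdd ∈ corootLattice P}
  one_mem' := (corootLattice P).zero_mem
  mul_mem' {a _} ha hb := add_mem (S := AddSubgroup Y) ha (smul_mem_corootLattice P a.right hb)
  inv_mem' {a} ha := smul_mem_corootLattice P a.right⁻¹ (neg_mem (S := AddSubgroup Y) ha)

variable (Y) in
/-- The real vector space `V = X_* ⊗ ℝ`. -/
abbrev V : Type _ := ℝ ⊗[ℤ] Y

/-- The real linear form `v ↦ ⟨α, v⟩` on `V` given by the root `α` with index `i`. -/
def pair (i : ι) : V Y →ₗ[ℝ] ℝ := Module.Dual.baseChange ℝ (P.root' i)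

theorem pair_tmul (i : ι) (r : ℝ) (ν : Y) : pair P i (r ⊗ₜ[ℤ] ν) = r * (P.root' i ν : ℤ) := by
  simp [pair, mul_comm]

/-- The action of the extended affine Weyl group on `V` by affine transformations:
`t_ν w` sends `v` to `w(v) + ν`. -/
def act (x : ExtAffineWeyl P) (v : V Y) : V Y :=
  ((x.right : Y ≃ₗ[ℤ] Y).toLinearMap.baseChange ℝ) v + (1 : ℝ) ⊗ₜ[ℤ] x.left.toAdd

theorem act_one (v : V Y) : act P 1 v = v := by
  change LinearMap.baseChange ℝ (LinearMap.id : Y →ₗ[ℤ] Y) v + (1 : ℝ) ⊗ₜ[ℤ] (0 : Y) = v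
  simp

theorem act_mul (x y : ExtAffineWeyl P) (v : V Y) : act P (x * y) v = act P x (act P y v) := by
  change LinearMap.baseChange ℝ
      ((x.right : Y ≃ₗ[ℤ] Y).toLinearMap ∘ₗ (y.right : Y ≃ₗ[ℤ] Y).toLinearMap) v
      + (1 : ℝ) ⊗ₜ[ℤ] (x.left.toAdd + (x.right : Y ≃ₗ[ℤ] Y) y.left.toAdd) = _
  simp only [act, LinearMap.baseChange_comp, LinearMap.comp_apply, map_add,
    LinearMap.baseChange_tmul, TensorProduct.tmul_add, LinearEquiv.coe_coe]
  abel

variable {P} (b : P.Base)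

/-- The root with index `θ` is the highest root: for every root `β`, the difference `θ - β` is a
sum of simple roots. (Such a root is unique, and exists if the root system is irreducible, which
is the case in which the notions below are used.) -/
def IsHighest (θ : ι) : Prop :=
  ∀ j, P.root θ - P.root j ∈ AddSubmonoid.closure (P.root '' b.support)

/-- The base alcove. -/
def alcove : Set (V Y) :=
  {v | (∀ i ∈ b.support, 0 < pair P i v) ∧ ∀ θ, IsHighest b θ → pair P θ v < 1}

/-- The closure of the base alcove for the canonical topology of the real vector space `V`. -/
def closedAlcove : Set (V Y) := @closure (V Y) (moduleTopology ℝ (V Y)) (alcove b)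

/-- The stabilizer `Ω` of the base alcove in the extended affine Weyl group. -/
def stab : Set (ExtAffineWeyl P) := {x | act P x '' alcove b = alcove b}

/-- The simple reflections of the affine Weyl group, that is, the reflections in the walls of the
base alcove: the simple reflections of the finite Weyl group, together with
`s_0 = t_{θ^∨} s_θ` for `θ` the highest root. -/
def simpleReflections : Set (affineWeyl P) :=
  {y | (∃ i ∈ b.support, (y : ExtAffineWeyl P) = fin P (refl P i)) ∨
    ∃ θ, IsHighest b θ ∧ (y : ExtAffineWeyl P) = t P (P.coroot θ) * fin P (refl P θ)}

/-- The Bruhat order on the extended affine Weyl group: `y ω ≤ y' ω'` if and only if `ω = ω'` and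
`y ≤ y'`, for `y, y'` in the affine Weyl group and `ω, ω'` in the stabilizer of the alcove. -/
def bruhatLE (x x' : ExtAffineWeyl P) : Prop :=
  ∃ y y' : affineWeyl P, ∃ ω ∈ stab b, x = y * ω ∧ x' = y' * ω ∧
    Bruhat.le (simpleReflections b) y y'

/-- The `μ`-admissible set. -/
def Adm (μ : Y) : Set (ExtAffineWeyl P) :=
  {x | ∃ w : W P, bruhatLE b x (t P ((w : Y ≃ₗ[ℤ] Y) μ))}

variable (P) in
/-- The convex hull `P_μ` in `V` of the Weyl group orbit of `μ`. -/
def hull (μ : Y) : Set (V Y) :=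
  convexHull ℝ {v | ∃ w : W P, v = (1 : ℝ) ⊗ₜ[ℤ] (w : Y ≃ₗ[ℤ] Y) μ}

/-- The `μ`-permissible set: `x` and `t_μ` have the same component in `Ω`, and `x` moves every
point of the closed base alcove by a vector in `P_μ`. -/
def Perm (μ : Y) : Set (ExtAffineWeyl P) :=
  {x | (∃ y₁ y₂ : affineWeyl P, ∃ ω ∈ stab b, x = y₁ * ω ∧ t P μ = y₂ * ω) ∧
    ∀ v ∈ closedAlcove b, act P x v - v ∈ hull P μ}

variable (P) in
/-- `μ` is minuscule: `⟨α, μ⟩ ∈ {-1, 0, 1}` for every root `α`. -/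
def IsMinuscule (μ : Y) : Prop :=
  ∀ i, P.root' i μ = -1 ∨ P.root' i μ = 0 ∨ P.root' i μ = 1

/-- `μ` is dominant: `⟨α, μ⟩ ≥ 0` for every simple root `α`. -/
def IsDominant (μ : Y) : Prop := ∀ i ∈ b.support, 0 ≤ P.root' i μ

end RootDatum

/-! ### The root datum `(Q(R), P(R^∨))` for `R` of type `E₆` -/

namespace E6

open Matrix

/-- The lattice `ℤ^6`. As character lattice `X^* = Q(R)`, coordinates are with respect to the
simple roots; as cocharacter lattice `X_* = P(R^∨)`, they are with respect to the dual basis of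
fundamental coweights. -/
abbrev L : Type := Fin 6 → ℤ

/-- The invariant form of the root lattice, normalized so that all roots have square length 2. -/
def q (m n : L) : ℤ := m ⬝ᵥ (CartanMatrix.E₆ *ᵥ n)

/-- The roots: the vectors of square length 2 in the root lattice. -/
abbrev Idx : Type := {n : L // q n n = 2}

theorem q_comm (m n : L) : q m n = q n m := by
  simp [q, CartanMatrix.E₆, dotProduct, mulVec, Fin.sum_univ_succ]
  ring

theorem q_add (k m n : L) : q (k + m) n = q k n + q m n := by simp [q, add_dotProduct]

theorem q_smul (a : ℤ) (m n : L) : q (a • m) n = a * q m n := by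
  rw [q, smul_dotProduct, smul_eq_mul, q]

theorem q_reflect {m : L} (n : L) (hm : q m m = 2) :
    q (n - q n m • m) (n - q n m • m) = q n n := by
  rw [sub_eq_add_neg, ← neg_smul]
  generalize hc : q n m = c
  rw [q_add, q_smul, q_comm n, q_comm m, q_add, q_add, q_smul, q_smul, q_comm m n, hm, hc]
  ring

theorem mulVec_injective {m n : L} (h : CartanMatrix.E₆ *ᵥ m = CartanMatrix.E₆ *ᵥ n) : m = n := by
  have h' : ∀ i, (CartanMatrix.E₆ *ᵥ m) i = (CartanMatrix.E₆ *ᵥ n) i := fun i => by rw [h]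
  simp [CartanMatrix.E₆, dotProduct, mulVec, Fin.sum_univ_succ, Fin.forall_fin_succ] at h'
  ext i
  fin_cases i <;> simp <;> lia

/-- The permutation of the roots induced by the reflection of the root `i`. -/
def reflPerm (i : Idx) : Idx ≃ Idx :=
  Function.Involutive.toPerm (fun j => ⟨j.1 - q j.1 i.1 • i.1, (q_reflect _ i.2).trans j.2⟩) (by
    intro j
    apply Subtype.ext
    have : q (j.1 - q j.1 i.1 • i.1) i.1 = - q j.1 i.1 := by
      rw [sub_eq_add_neg, ← neg_smul, q_add, q_smul, i.2]; ring
    simp only [this]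
    module)

/-- The root datum `(Q(R), P(R^∨))` of type `E₆`, with the standard pairing of `ℤ^6` with itself.
The coroot of a root `n` is the cocharacter `m ↦ q m n`, since all roots have square length 2. -/
def datum : RootDatum Idx L L where
  toLinearMap := dotProductBilin ℤ ℤ
  isPerfPair_toLinearMap := by
    apply LinearMap.IsPerfPair.of_bijective
    constructor
    · intro m n h
      ext i
      simpa using LinearMap.congr_fun h (Pi.single i 1)
    · intro f
      refine ⟨fun i => f (Pi.single i 1), LinearMap.pi_ext' fun i => ?_⟩
      ext
      simp
  root := Function.Embedding.subtype _
  coroot := ⟨fun n => CartanMatrix.E₆ *ᵥ n.1, fun _ _ h => Subtype.ext (mulVec_injective h)⟩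
  root_coroot_two n := n.2
  reflectionPerm := reflPerm
  reflectionPerm_root _ _ := rfl
  reflectionPerm_coroot i j := by
    change CartanMatrix.E₆ *ᵥ j.1 - q i.1 j.1 • CartanMatrix.E₆ *ᵥ i.1 =
      CartanMatrix.E₆ *ᵥ (j.1 - q j.1 i.1 • i.1)
    rw [mulVec_sub, mulVec_smul, q_comm]

/-- The simple roots `α_1, …, α_6`, as `simple 0, …, simple 5`. -/
def simple (i : Fin 6) : Idx := ⟨Pi.single i 1, by fin_cases i <;> decide⟩

theorem simple_injective : Function.Injective simple := fun i j h => by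
  by_contra hij
  simpa [simple, Pi.single_apply, hij] using congrFun (congrArg Subtype.val h) i

theorem q_self (n : L) : q n n = 2 * (n 0 ^ 2 + n 1 ^ 2 + n 2 ^ 2 + n 3 ^ 2 + n 4 ^ 2 + n 5 ^ 2
    - n 0 * n 2 - n 1 * n 3 - n 2 * n 3 - n 3 * n 4 - n 4 * n 5) := by
  simp [q, CartanMatrix.E₆, dotProduct, mulVec, Fin.sum_univ_succ]
  ring

/-- The form is positive definite. -/
theorem q_pos {n : L} (hn : n ≠ 0) : 2 ≤ q n n := by
  have key : 12 * q n n = 6 * (2 * n 0 - n 2) ^ 2 + 6 * (2 * n 1 - n 3) ^ 2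
      + 2 * (3 * n 2 - 2 * n 3) ^ 2 + 6 * (2 * n 5 - n 4) ^ 2 + 2 * (3 * n 4 - 2 * n 3) ^ 2
      + 2 * n 3 ^ 2 := by
    rw [q_self]; ring
  by_contra! hlt
  have heven : q n n ≤ 0 := by rw [q_self] at hlt ⊢; lia
  apply hn
  have h1 : (2 * n 0 - n 2) ^ 2 = 0 := by nlinarith
  have h2 : (2 * n 1 - n 3) ^ 2 = 0 := by nlinarith
  have h3 : (3 * n 2 - 2 * n 3) ^ 2 = 0 := by nlinarith
  have h4 : (2 * n 5 - n 4) ^ 2 = 0 := by nlinarith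
  have h5 : (3 * n 4 - 2 * n 3) ^ 2 = 0 := by nlinarith
  have h6 : n 3 ^ 2 = 0 := by nlinarith
  simp only [pow_eq_zero_iff, ne_eq, OfNat.ofNat_ne_zero, not_false_eq_true] at h1 h2 h3 h4 h5 h6
  ext i
  fin_cases i <;> simp <;> lia

/-- Every root is a sum of simple roots or the negative of such a sum. -/
theorem nonneg_or_nonpos (n : Idx) : (∀ i, 0 ≤ n.1 i) ∨ (∀ i, 0 ≤ -n.1 i) := by
  obtain ⟨n, hn⟩ := n
  have hp : ∀ i, 0 ≤ (n⁺) i ∧ 0 ≤ (n⁻) i ∧ (n⁺) i * (n⁻) i = 0 ∧ n i = (n⁺) i - (n⁻) i := by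
    intro i
    rw [Pi.posPart_apply, Pi.negPart_apply]
    rcases le_total 0 (n i) with h | h
    · simp [h]
    · simp [h]
  generalize n⁺ = p at hp
  generalize n⁻ = m at hp
  have hnpm : n = p + (-1 : ℤ) • m := by ext i; simp [(hp i).2.2.2, sub_eq_add_neg]
  have hpm : q p m ≤ 0 := by
    have e : q p m = 2 * (p 0 * m 0 + p 1 * m 1 + p 2 * m 2 + p 3 * m 3 + p 4 * m 4 + p 5 * m 5)
        - p 0 * m 2 - p 2 * m 0 - p 1 * m 3 - p 3 * m 1 - p 2 * m 3 - p 3 * m 2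
        - p 3 * m 4 - p 4 * m 3 - p 4 * m 5 - p 5 * m 4 := by
      simp [q, CartanMatrix.E₆, dotProduct, mulVec, Fin.sum_univ_succ]
      ring
    rw [e]
    simp only [(hp _).2.2.1]
    have h := fun i j => mul_nonneg (hp i).1 (hp j).2.1
    linarith [h 0 2, h 2 0, h 1 3, h 3 1, h 2 3, h 3 2, h 3 4, h 4 3, h 4 5, h 5 4]
  have hq : q n n = q p p + q m m - 2 * q p m := by
    rw [hnpm, q_add, q_smul, q_comm p, q_comm m, q_add, q_add, q_smul, q_smul, q_comm m p]
    ring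
  by_cases h0 : p = 0
  · right
    intro i
    have := hp i
    simp only [h0, Pi.zero_apply] at this
    change 0 ≤ -n i
    lia
  by_cases h1 : m = 0
  · left
    intro i
    have := hp i
    simp only [h1, Pi.zero_apply] at this
    change 0 ≤ n i
    lia
  have := q_pos h0
  have := q_pos h1
  lia

theorem mem_closure_simple {n : L} (hn : ∀ i, 0 ≤ n i) :
    n ∈ AddSubmonoid.closure (datum.root '' (Finset.univ.image simple : Finset Idx)) := by
  have : n = ∑ i, (n i).toNat • datum.root (simple i) := by
    ext j
    have : ∀ i, datum.root (simple i) = Pi.single i 1 := fun _ => rfl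
    simp [this, Finset.sum_apply, Pi.single_apply, hn]
  rw [this]
  refine sum_mem fun i _ => nsmul_mem (AddSubmonoid.subset_closure
    (Set.mem_image_of_mem _ (by simp))) _

/-- The action of the Cartan matrix, which sends roots to coroots. -/
def toCoroot : L →ₗ[ℤ] L := CartanMatrix.E₆.mulVecLin

theorem mem_closure_simple' {n : L} (hn : ∀ i, 0 ≤ n i) :
    toCoroot n ∈ AddSubmonoid.closure (datum.coroot '' (Finset.univ.image simple : Finset Idx)) := by
  have h := AddSubmonoid.mem_map_of_mem toCoroot.toAddMonoidHom (mem_closure_simple hn)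
  rw [AddMonoidHom.map_mclosure, Set.image_image] at h
  exact h

theorem linearIndepOn_root :
    LinearIndepOn ℤ datum.root ((Finset.univ.image simple : Finset Idx) : Set Idx) := by
  have h := (Pi.basisFun ℤ (Fin 6)).linearIndependent
  have h2 : LinearIndependent ℤ (datum.root ∘ simple) := by
    convert h using 1
    · ext i : 1
      simp [datum, simple]
    · exact Subsingleton.elim _ _
  rw [Finset.coe_image, Finset.coe_univ, Set.image_univ]
  exact (linearIndepOn_range_iff simple_injective _).2 h2

/-- The base `α_1, …, α_6`. -/
def base : datum.Base where
  support := Finset.univ.image simple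
  linearIndepOn_root := linearIndepOn_root
  linearIndepOn_coroot := linearIndepOn_root.map_injOn toCoroot
    (fun _ _ _ _ h => mulVec_injective h)
  root_mem_or_neg_mem n := (nonneg_or_nonpos n).imp mem_closure_simple mem_closure_simple
  coroot_mem_or_neg_mem n := (nonneg_or_nonpos n).imp mem_closure_simple'
    (fun h => by
      have := mem_closure_simple' (n := -n.1) h
      rwa [map_neg] at this)

/-- The Cartan matrix of the base is the one of type `E₆`. -/
theorem pairing_simple (i j : Fin 6) :
    datum.pairing (simple i) (simple j) = CartanMatrix.E₆ i j := by
  fin_cases i <;> fin_cases j <;> decide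

/-- The character lattice is the root lattice. -/
theorem span_root : Submodule.span ℤ (Set.range datum.root) = ⊤ := by
  refine eq_top_iff.2 fun n _ => ?_
  rw [pi_eq_sum_univ n]
  refine sum_mem fun i _ => Submodule.smul_mem _ _ (Submodule.subset_span ⟨simple i, ?_⟩)
  ext j
  simp [datum, simple, Pi.single_apply, eq_comm]

/-- The fundamental coweights: `rho i` is the element of `P(R^∨)` dual to `simple i`. Hence `ρ_1`
is `rho 0` and `ρ_6` is `rho 5`. -/
def rho (i : Fin 6) : L := Pi.single i 1

theorem root_rho (i j : Fin 6) : datum.root' (simple i) (rho j) = if i = j then 1 else 0 := by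
  revert i j
  decide

/-- The simple reflections of the finite Weyl group: `s_1, …, s_6` are `s 0, …, s 5`. -/
def s (i : Fin 6) : RootDatum.W datum := RootDatum.refl datum (simple i)

/-- `w_1 = s_2 s_4 s_5 s_6 s_3 s_4 s_5 s_2 s_4 s_3 s_1`. -/
def w₁ : RootDatum.W datum := s 1 * s 3 * s 4 * s 5 * s 2 * s 3 * s 4 * s 1 * s 3 * s 2 * s 0

/-- `w_2 = s_4 s_5 s_6 s_2 s_4 s_5`. -/
def w₂ : RootDatum.W datum := s 3 * s 4 * s 5 * s 1 * s 3 * s 4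

/-- The element `x = w_2 t_μ w_1^{-1}` for `μ = ρ_1`. -/
def x : RootDatum.ExtAffineWeyl datum :=
  RootDatum.fin datum w₂ * RootDatum.t datum (rho 0) * (RootDatum.fin datum w₁)⁻¹

end E6

/-! Permissibility of `x` is a convexity certificate. The map `v ↦ x(v) - v` is affine, so it only
has to be tested at the vertices of the base alcove, namely `0` and `ρ_i / θ_i` with `θ_i` the
coefficients of the highest root. At `0` the displacement lies in the orbit of `μ`; at `ρ_i / θ_i`
it is exhibited as an average of `θ_i` orbit elements (`mem_Perm`, `elt_mem_Perm`).

Non-admissibility comes from following one vertex, `v = ρ₄ / 3`, up the Bruhat order. Let `d = 3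
(x(v) - v)`. An upward step reflects in an affine root that is positive both on the base alcove and
on the current alcove (`exists_of_step`), so it is nonnegative at `v` and at `x(v)`. Hence, once
some root pairs with `d` to more than `3`, this persists for some possibly different root. From the
displacement of `x`, every step either produces such a long vector or stays in a three-element set
`U`; thus `Bad U` is inherited upwards (`Bad.step`, `Bad.of_le`). A translation by a minuscule `ν`
has `d = 3ν`: its pairings with roots are at most `3`, and its coordinates are divisible by `3`,
unlike the fourth coordinate of the vectors in `U`. So no such translation lies above `x`
(`not_mem_Adm`).

The description of upward steps needs the standard Coxeter theory of the affine Weyl group: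
generation by the wall reflections (`mem_simpleSpan`) and strong exchange (`strong_exchange`). Signs
of affine roots are read off at the barycentre `ρ^∨ / 12`, where `12` is the Coxeter number, so
everything becomes integer arithmetic.

The case of `ρ_6` uses the image of `x` under the diagram automorphism. Every nonzero minuscule
coweight is conjugate to `ρ_1` or `ρ_6`, and both sets depend only on the Weyl orbit. -/

namespace E6
open Matrix RootDatum

/-! ### Enumeration of the roots -/

/-- The positive roots, ordered by height. -/
def posRoots : List L := [
  ![0, 0, 0, 0, 0, 1], ![0, 0, 0, 0, 1, 0], ![0, 0, 0, 1, 0, 0], ![0, 0, 1, 0, 0, 0],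
  ![0, 1, 0, 0, 0, 0], ![1, 0, 0, 0, 0, 0], ![0, 0, 0, 0, 1, 1], ![0, 0, 0, 1, 1, 0],
  ![0, 0, 1, 1, 0, 0], ![0, 1, 0, 1, 0, 0], ![1, 0, 1, 0, 0, 0], ![0, 0, 0, 1, 1, 1],
  ![0, 0, 1, 1, 1, 0], ![0, 1, 0, 1, 1, 0], ![0, 1, 1, 1, 0, 0], ![1, 0, 1, 1, 0, 0],
  ![0, 0, 1, 1, 1, 1], ![0, 1, 0, 1, 1, 1], ![0, 1, 1, 1, 1, 0], ![1, 0, 1, 1, 1, 0],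
  ![1, 1, 1, 1, 0, 0], ![0, 1, 1, 1, 1, 1], ![0, 1, 1, 2, 1, 0], ![1, 0, 1, 1, 1, 1],
  ![1, 1, 1, 1, 1, 0], ![0, 1, 1, 2, 1, 1], ![1, 1, 1, 1, 1, 1], ![1, 1, 1, 2, 1, 0],
  ![0, 1, 1, 2, 2, 1], ![1, 1, 1, 2, 1, 1], ![1, 1, 2, 2, 1, 0], ![1, 1, 1, 2, 2, 1],
  ![1, 1, 2, 2, 1, 1], ![1, 1, 2, 2, 2, 1], ![1, 1, 2, 3, 2, 1], ![1, 2, 2, 3, 2, 1]]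

/-- All roots. -/
def roots : List L := posRoots ++ posRoots.map Neg.neg

-- A finite search; the ranges are exactly those that the sum-of-squares form of `q` yields in
-- `mem_posRoots`.
set_option synthInstance.maxHeartbeats 400000 in
set_option synthInstance.maxSize 4000 in
theorem mem_posRoots_of_bounded : ∀ d < (4 : ℕ), ∀ b < (3 : ℕ), ∀ c < (4 : ℕ),
    ∀ e < (4 : ℕ), ∀ a < (3 : ℕ), ∀ f < (3 : ℕ),
    (a : ℤ) ^ 2 + b ^ 2 + c ^ 2 + d ^ 2 + e ^ 2 + f ^ 2
      - a * c - b * d - c * d - d * e - e * f = 1 →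
    (![(a : ℤ), b, c, d, e, f] : L) ∈ posRoots := by
  decide +kernel

theorem mem_posRoots (n : Idx) (h : ∀ i, 0 ≤ n.1 i) : n.1 ∈ posRoots := by
  obtain ⟨n, hn⟩ := n
  simp only at h ⊢
  -- Completing squares outwards from the branch node. With `q n n = 2` the total is `24`, so each
  -- square is bounded separately.
  have key : 12 * q n n = 6 * (2 * n 0 - n 2) ^ 2 + 6 * (2 * n 1 - n 3) ^ 2
      + 2 * (3 * n 2 - 2 * n 3) ^ 2 + 6 * (2 * n 5 - n 4) ^ 2 + 2 * (3 * n 4 - 2 * n 3) ^ 2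
      + 2 * n 3 ^ 2 := by
    rw [q_self]; ring
  rw [hn] at key
  have b3 : n 3 < 4 := by nlinarith [h 3]
  have b1 : 2 * n 1 - n 3 ≤ 2 := by nlinarith
  have b2 : 3 * n 2 - 2 * n 3 ≤ 3 := by nlinarith
  have b4 : 3 * n 4 - 2 * n 3 ≤ 3 := by nlinarith
  have b0 : 2 * n 0 - n 2 ≤ 2 := by nlinarith
  have b5 : 2 * n 5 - n 4 ≤ 2 := by nlinarith
  rw [q_self] at hn
  obtain ⟨a, ha⟩ := Int.eq_ofNat_of_zero_le (h 0)
  obtain ⟨b, hb⟩ := Int.eq_ofNat_of_zero_le (h 1)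
  obtain ⟨c, hc⟩ := Int.eq_ofNat_of_zero_le (h 2)
  obtain ⟨d, hd⟩ := Int.eq_ofNat_of_zero_le (h 3)
  obtain ⟨e, he⟩ := Int.eq_ofNat_of_zero_le (h 4)
  obtain ⟨f, hf⟩ := Int.eq_ofNat_of_zero_le (h 5)
  have hv : n = ![(a : ℤ), b, c, d, e, f] := by
    ext i
    fin_cases i <;> simp [*]
  rw [ha, hb, hc, hd, he, hf] at hn
  rw [hv]
  exact mem_posRoots_of_bounded d (by lia) b (by lia) c (by lia) e (by lia) a (by lia) f
    (by lia) (by linarith)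

theorem mem_roots (n : Idx) : n.1 ∈ roots := by
  rcases nonneg_or_nonpos n with h | h
  · exact List.mem_append_left _ (mem_posRoots n h)
  · have hn : q (-n.1) (-n.1) = 2 := by
      have := q_self n.1
      rw [n.2] at this
      rw [q_self]
      simp only [Pi.neg_apply]
      linarith
    have := mem_posRoots ⟨-n.1, hn⟩ h
    exact List.mem_append_right _ (List.mem_map.2 ⟨_, this, neg_neg _⟩)

/-- The highest root. -/
def theta : Idx := ⟨![1, 2, 2, 3, 2, 1], by decide⟩

theorem le_theta (n : Idx) (i : Fin 6) : n.1 i ≤ theta.1 i := by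
  have : ∀ n ∈ roots, ∀ i, n i ≤ theta.1 i := by decide +kernel
  exact this _ (mem_roots n) i

theorem neg_theta_le (n : Idx) (i : Fin 6) : - theta.1 i ≤ n.1 i := by
  have : ∀ n ∈ roots, ∀ i, - theta.1 i ≤ n i := by decide +kernel
  exact this _ (mem_roots n) i

/-- The height of a root, as the pairing with this coweight. -/
def one : L := fun _ => 1

/-- Heights are nonzero and smaller in absolute value than the Coxeter number `12`; hence no affine
root vanishes at the barycentre. -/
theorem ht_bound (n : Idx) : -11 ≤ n.1 ⬝ᵥ one ∧ n.1 ⬝ᵥ one ≤ 11 ∧ n.1 ⬝ᵥ one ≠ 0 := by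
  have : ∀ n ∈ roots, -11 ≤ n ⬝ᵥ one ∧ n ⬝ᵥ one ≤ 11 ∧ n ⬝ᵥ one ≠ 0 := by decide +kernel
  exact this _ (mem_roots n)

theorem support_base : (base.support : Set Idx) = Set.range simple := by
  simp [base]

theorem nonneg_of_mem_closure {n : L}
    (h : n ∈ AddSubmonoid.closure (datum.root '' base.support)) (i : Fin 6) : 0 ≤ n i := by
  induction h using AddSubmonoid.closure_induction with
  | mem x hx =>
    rw [support_base] at hx
    obtain ⟨_, ⟨j, rfl⟩, rfl⟩ := hx
    change 0 ≤ (Pi.single j 1 : L) i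
    rw [Pi.single_apply]
    split <;> simp
  | zero => simp
  | add x y _ _ hx hy => exact add_nonneg hx hy

theorem isHighest_iff (n : Idx) : RootDatum.IsHighest base n ↔ n = theta := by
  constructor
  · intro h
    apply Subtype.ext
    ext i
    exact le_antisymm (le_theta n i) (sub_nonneg.1 (nonneg_of_mem_closure (h theta) i))
  · rintro rfl j
    exact mem_closure_simple fun i => sub_nonneg.2 (le_theta j i)


/-! ### The action on integral vectors and affine roots -/

/-- The element `g = t_ν w` sends `N⁻¹ z` to `N⁻¹ (ev N g z)`. -/
def ev (N : ℤ) (g : ExtAffineWeyl datum) (z : L) : L :=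
  N • (g.left.toAdd : L) + (g.right : L ≃ₗ[ℤ] L) z

theorem ev_one (N : ℤ) (z : L) : ev N 1 z = z := by
  change N • (0 : L) + z = z
  simp

theorem ev_mul (N : ℤ) (g h : ExtAffineWeyl datum) (z : L) :
    ev N (g * h) z = ev N g (ev N h z) := by
  change N • ((g.left.toAdd : L) + (g.right : L ≃ₗ[ℤ] L) h.left.toAdd)
    + (g.right : L ≃ₗ[ℤ] L) ((h.right : L ≃ₗ[ℤ] L) z) = _
  simp only [ev, map_add, map_smul, smul_add, add_assoc]

theorem coreflection_apply (n : Idx) (v : L) :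
    datum.coreflection n v = v - (n.1 ⬝ᵥ v) • (CartanMatrix.E₆ *ᵥ n.1) := by
  rw [RootPairing.coreflection_apply]
  rfl

theorem dotProduct_coroot (m n : L) : m ⬝ᵥ (CartanMatrix.E₆ *ᵥ n) = q m n := rfl

theorem reflPerm_dotProduct (i n : Idx) (v : L) :
    (reflPerm i n).1 ⬝ᵥ v = n.1 ⬝ᵥ datum.coreflection i v := by
  rw [coreflection_apply]
  change (n.1 - q n.1 i.1 • i.1) ⬝ᵥ v = _
  rw [sub_dotProduct, smul_dotProduct, dotProduct_sub, dotProduct_smul, dotProduct_coroot]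
  simp only [smul_eq_mul]
  ring

theorem reflPerm_coroot (i n : Idx) :
    datum.coreflection i (CartanMatrix.E₆ *ᵥ (reflPerm i n).1) = CartanMatrix.E₆ *ᵥ n.1 := by
  have hi := i.2
  rw [coreflection_apply]
  change _ - (i.1 ⬝ᵥ (CartanMatrix.E₆ *ᵥ (n.1 - q n.1 i.1 • i.1))) •
    (CartanMatrix.E₆ *ᵥ i.1) = _
  rw [mulVec_sub, mulVec_smul, dotProduct_sub, dotProduct_smul]
  simp only [dotProduct_coroot, hi, q_comm i.1 n.1, smul_eq_mul]
  rw [show CartanMatrix.E₆ *ᵥ (reflPerm i n).1 = CartanMatrix.E₆ *ᵥ n.1 -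
    q n.1 i.1 • (CartanMatrix.E₆ *ᵥ i.1) by rw [← mulVec_smul, ← mulVec_sub]; rfl]
  module

/-- The composite of a root with an element of the Weyl group is a root. -/
theorem exists_root_comp (w : W datum) : ∀ n : Idx, ∃ n' : Idx,
    (∀ v : L, n.1 ⬝ᵥ (w : L ≃ₗ[ℤ] L) v = n'.1 ⬝ᵥ v) ∧
      (w : L ≃ₗ[ℤ] L) (CartanMatrix.E₆ *ᵥ n'.1) = CartanMatrix.E₆ *ᵥ n.1 := by
  obtain ⟨w, hw⟩ := w
  change ∀ n : Idx, ∃ n' : Idx, (∀ v : L, n.1 ⬝ᵥ w v = n'.1 ⬝ᵥ v) ∧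
      w (CartanMatrix.E₆ *ᵥ n'.1) = CartanMatrix.E₆ *ᵥ n.1
  have key : ∀ i n : Idx, ∃ n' : Idx, (∀ v : L, n.1 ⬝ᵥ datum.coreflection i v = n'.1 ⬝ᵥ v) ∧
      datum.coreflection i (CartanMatrix.E₆ *ᵥ n'.1) = CartanMatrix.E₆ *ᵥ n.1 := fun i n =>
    ⟨reflPerm i n, fun v => (reflPerm_dotProduct i n v).symm, reflPerm_coroot i n⟩
  induction hw using Subgroup.closure_induction'' with
  | mem w hw =>
    obtain ⟨i, rfl⟩ := hw
    exact key i
  | inv_mem w hw =>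
    obtain ⟨i, rfl⟩ := hw
    have : (datum.coreflection i)⁻¹ = datum.coreflection i := datum.coreflection_inv i
    rw [this]
    exact key i
  | one => exact fun n => ⟨n, fun _ => rfl, rfl⟩
  | mul a b _ _ ha hb =>
    intro n
    obtain ⟨n₁, h₁, h₁'⟩ := ha n
    obtain ⟨n₂, h₂, h₂'⟩ := hb n₁
    refine ⟨n₂, fun v => ?_, ?_⟩
    · rw [← h₂, ← h₁]; rfl
    · rw [← h₁', ← h₂']; rfl

/-- The reflection in the zero hyperplane of the affine root `n + k`. -/
def afr (n : Idx) (k : ℤ) : ExtAffineWeyl datum :=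
  ⟨Multiplicative.ofAdd (-k • (CartanMatrix.E₆ *ᵥ n.1)), refl datum n⟩

theorem refl_apply (n : Idx) (v : L) : ((refl datum n : W datum) : L ≃ₗ[ℤ] L) v =
    v - (n.1 ⬝ᵥ v) • (CartanMatrix.E₆ *ᵥ n.1) := coreflection_apply n v

theorem ev_afr (N k : ℤ) (n : Idx) (z : L) :
    ev N (afr n k) z = z - (n.1 ⬝ᵥ z + N * k) • (CartanMatrix.E₆ *ᵥ n.1) := by
  change N • (-k • (CartanMatrix.E₆ *ᵥ n.1)) + ((refl datum n : W datum) : L ≃ₗ[ℤ] L) z = _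
  rw [refl_apply]
  module

/-- The composite of an affine root with an element of the extended affine Weyl group. -/
theorem exists_comp (g : ExtAffineWeyl datum) (n : Idx) (k : ℤ) : ∃ (n' : Idx) (k' : ℤ),
    (∀ N z, n.1 ⬝ᵥ ev N g z + N * k = n'.1 ⬝ᵥ z + N * k') ∧ afr n k * g = g * afr n' k' := by
  obtain ⟨n', h, h'⟩ := exists_root_comp g.right n
  -- The constant term does not depend on the scale `N`, so one affine root serves the barycentre
  -- (`N = 12`), the vertex (`N = 3`) and the linear part (`N = 0`).
  refine ⟨n', n.1 ⬝ᵥ (g.left.toAdd : L) + k, fun N z => ?_, ?_⟩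
  · rw [ev, dotProduct_add, dotProduct_smul, h]
    simp only [smul_eq_mul]
    ring
  · refine SemidirectProduct.ext ?_ ?_
    · apply Multiplicative.toAdd.injective
      change -k • (CartanMatrix.E₆ *ᵥ n.1) + ((refl datum n : W datum) : L ≃ₗ[ℤ] L) g.left.toAdd
        = (g.left.toAdd : L) + (g.right : L ≃ₗ[ℤ] L)
          (-(n.1 ⬝ᵥ (g.left.toAdd : L) + k) • (CartanMatrix.E₆ *ᵥ n'.1))
      rw [map_smul, h', refl_apply]
      module
    · apply Subtype.ext
      apply LinearEquiv.ext
      intro v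
      change ((refl datum n : W datum) : L ≃ₗ[ℤ] L) ((g.right : L ≃ₗ[ℤ] L) v) =
        (g.right : L ≃ₗ[ℤ] L) (((refl datum n' : W datum) : L ≃ₗ[ℤ] L) v)
      rw [refl_apply, refl_apply, h, map_sub, map_smul, h']

theorem afr_neg (n n' : Idx) (k : ℤ) (h : n'.1 = -n.1) : afr n' (-k) = afr n k := by
  refine SemidirectProduct.ext ?_ ?_
  · apply Multiplicative.toAdd.injective
    change - -k • (CartanMatrix.E₆ *ᵥ n'.1) = -k • (CartanMatrix.E₆ *ᵥ n.1)
    rw [h, mulVec_neg]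
    module
  · apply Subtype.ext
    apply LinearEquiv.ext
    intro v
    change ((refl datum n' : W datum) : L ≃ₗ[ℤ] L) v = ((refl datum n : W datum) : L ≃ₗ[ℤ] L) v
    rw [refl_apply, refl_apply, h, mulVec_neg, neg_dotProduct]
    module

/-- The opposite of a root. -/
def opp (n : Idx) : Idx := ⟨-n.1, by
  have := q_self n.1
  rw [n.2] at this
  rw [q_self]
  simp only [Pi.neg_apply]
  linarith⟩

theorem afr_mul_self (n : Idx) (k : ℤ) : afr n k * afr n k = 1 := by
  have h2 : n.1 ⬝ᵥ (CartanMatrix.E₆ *ᵥ n.1) = 2 := n.2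
  refine SemidirectProduct.ext ?_ ?_
  · apply Multiplicative.toAdd.injective
    change -k • (CartanMatrix.E₆ *ᵥ n.1) +
      ((refl datum n : W datum) : L ≃ₗ[ℤ] L) (-k • (CartanMatrix.E₆ *ᵥ n.1)) = 0
    rw [refl_apply, dotProduct_smul, h2]
    simp only [smul_eq_mul]
    module
  · apply Subtype.ext
    apply LinearEquiv.ext
    intro v
    change ((refl datum n : W datum) : L ≃ₗ[ℤ] L) (((refl datum n : W datum) : L ≃ₗ[ℤ] L) v) = v
    rw [refl_apply, refl_apply, dotProduct_sub, dotProduct_smul, h2]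
    simp only [smul_eq_mul]
    module

theorem afr_mem (n : Idx) (k : ℤ) : afr n k ∈ affineWeyl datum := by
  change -k • (CartanMatrix.E₆ *ᵥ n.1) ∈ corootLattice datum
  exact zsmul_mem (AddSubgroup.subset_closure (Set.mem_range_self (f := datum.coroot) n)) _

/-- The affine reflection as an element of the affine Weyl group. -/
def afrW (n : Idx) (k : ℤ) : affineWeyl datum := ⟨afr n k, afr_mem n k⟩

/-! ### Positive affine roots and the exchange property -/

/-- Positivity of the affine root `n + k` on the base alcove. -/
def Pos (n : Idx) (k : ℤ) : Prop := 0 < n.1 ⬝ᵥ one + 12 * k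

theorem val_ne_zero (n : Idx) (k : ℤ) : n.1 ⬝ᵥ one + 12 * k ≠ 0 := by
  have := ht_bound n
  lia

theorem one_apply (i : Fin 6) : one i = 1 := rfl

theorem dotProduct_one (n : L) : n ⬝ᵥ one = n 0 + n 1 + n 2 + n 3 + n 4 + n 5 := by
  simp [dotProduct, Fin.sum_univ_succ, one_apply]
  ring

theorem Pos.nonneg {n : Idx} {k : ℤ} (h : Pos n k) : 0 ≤ k := by
  have := ht_bound n
  unfold Pos at h
  lia

theorem Pos.nonneg_coeff {n : Idx} {k : ℤ} (h : Pos n k) (hk : k = 0) (i : Fin 6) :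
    0 ≤ n.1 i := by
  subst hk
  rcases nonneg_or_nonpos n with h' | h'
  · exact h' i
  · unfold Pos at h
    rw [dotProduct_one] at h
    have := h' 0; have := h' 1; have := h' 2; have := h' 3; have := h' 4; have := h' 5
    lia

/-- The simple affine roots take the value `1/12` at the barycentre of the base alcove. -/
theorem exists_of_mem_simpleReflections {y : affineWeyl datum}
    (hy : y ∈ simpleReflections base) :
    ∃ n k, n.1 ⬝ᵥ one + 12 * k = 1 ∧ y = afrW n k := by
  rcases hy with ⟨i, hi, h⟩ | ⟨θ, hθ, h⟩
  · have hi' : i ∈ Set.range simple := by rw [← support_base]; exact hi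
    obtain ⟨j, rfl⟩ := hi'
    refine ⟨simple j, 0, ?_, Subtype.ext ?_⟩
    · have : ∀ j, (simple j).1 ⬝ᵥ one + 12 * 0 = 1 := by decide
      exact this j
    · rw [h]
      refine SemidirectProduct.ext ?_ rfl
      apply Multiplicative.toAdd.injective
      change (0 : L) = -0 • _
      simp
  · rw [isHighest_iff] at hθ
    subst hθ
    refine ⟨opp theta, 1, by decide, Subtype.ext ?_⟩
    rw [h]
    change _ = afr (opp theta) 1
    rw [← neg_neg (1 : ℤ), afr_neg theta (opp theta) (-1) rfl]
    refine SemidirectProduct.ext ?_ ?_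
    · apply Multiplicative.toAdd.injective
      change CartanMatrix.E₆ *ᵥ theta.1 + (0 : L) = - -1 • (CartanMatrix.E₆ *ᵥ theta.1)
      simp
    · change 1 * refl datum theta = refl datum theta
      rw [one_mul]

theorem simple_mem (j : Fin 6) : afrW (simple j) 0 ∈ simpleReflections base := by
  left
  refine ⟨simple j, ?_, ?_⟩
  · change simple j ∈ (base.support : Set Idx)
    rw [support_base]; exact ⟨j, rfl⟩
  · refine SemidirectProduct.ext ?_ rfl
    apply Multiplicative.toAdd.injective
    change -0 • _ = (0 : L)
    simp

theorem affine_simple_mem : afrW theta (-1) ∈ simpleReflections base := by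
  right
  refine ⟨theta, (isHighest_iff _).2 rfl, ?_⟩
  refine SemidirectProduct.ext ?_ ?_
  · apply Multiplicative.toAdd.injective
    change - -1 • (CartanMatrix.E₆ *ᵥ theta.1) = CartanMatrix.E₆ *ᵥ theta.1 + (0 : L)
    simp
  · change refl datum theta = 1 * refl datum theta
    rw [one_mul]

/-- Positive definiteness gives `2 ≤ q (m - n) (m - n) = 4 - 2 q m n`. -/
theorem q_le_one {m n : Idx} (h : m ≠ n) : q m.1 n.1 ≤ 1 := by
  have h0 : m.1 - n.1 ≠ 0 := fun h' => h (Subtype.ext (sub_eq_zero.1 h'))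
  have := q_pos h0
  have e : q (m.1 - n.1) (m.1 - n.1) = q m.1 m.1 + q n.1 n.1 - 2 * q m.1 n.1 := by
    rw [sub_eq_add_neg, ← neg_one_smul ℤ n.1, q_add, q_smul, q_comm m.1, q_comm n.1 (m.1 + _),
      q_add, q_add, q_smul, q_smul, q_comm n.1 m.1]
    ring
  rw [e, m.2, n.2] at this
  lia

/-- A simple affine reflection makes only one positive affine root negative. -/
theorem eq_of_not_pos {m n : Idx} {j k : ℤ} (hs : n.1 ⬝ᵥ one + 12 * k = 1) (hp : Pos m j)
    (hn : m.1 ⬝ᵥ ev 12 (afr n k) one + 12 * j ≤ 0) : m = n ∧ j = k := by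
  rw [ev_afr, hs, one_smul, dotProduct_sub, dotProduct_coroot] at hn
  unfold Pos at hp
  by_cases h : m = n
  · subst h
    rw [m.2] at hn
    exact ⟨rfl, by lia⟩
  -- The value at the barycentre is a positive integer and drops by `q m n ≤ 1`, so it could only
  -- reach `0`; but affine roots never vanish at the barycentre of an alcove.
  · have h1 := q_le_one h
    obtain ⟨n', k', h', -⟩ := exists_comp (afr n k) m j
    have h2 := h' 12 one
    rw [ev_afr, hs, one_smul, dotProduct_sub, dotProduct_coroot] at h2
    have := val_ne_zero n' k'
    lia

/-- The strong exchange property. -/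
theorem strong_exchange (l : List (affineWeyl datum)) : ∀ (n : Idx) (k : ℤ),
    (∀ s ∈ l, s ∈ simpleReflections base) → Pos n k →
    n.1 ⬝ᵥ ev 12 (l.prod : affineWeyl datum) one + 12 * k < 0 →
    ∃ l' : List (affineWeyl datum), (∀ s ∈ l', s ∈ simpleReflections base) ∧
      l'.length < l.length ∧ l'.prod = afrW n k * l.prod := by
  induction l with
  | nil =>
    intro n k _ hp h
    simp only [List.prod_nil, OneMemClass.coe_one, ev_one] at h
    exact absurd h (not_lt.2 hp.le)
  | cons s l ih =>
    intro n k hl hp h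
    obtain ⟨m, j, hm, rfl⟩ := exists_of_mem_simpleReflections (hl s (by simp))
    have hl' : ∀ s ∈ l, s ∈ simpleReflections base := fun t ht => hl t (by simp [ht])
    rw [List.prod_cons, Subgroup.coe_mul, ev_mul] at h
    obtain ⟨n', k', hc, hc'⟩ := exists_comp (afr m j) n k
    -- If the first letter already makes the root nonpositive, that letter is the reflection itself
    -- and is deleted. Otherwise the root is pulled back through the letter and the deletion happens
    -- further on.
    by_cases hs : n.1 ⬝ᵥ ev 12 (afr m j) one + 12 * k ≤ 0
    · obtain ⟨rfl, rfl⟩ := eq_of_not_pos hm hp hs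
      refine ⟨l, hl', by simp, ?_⟩
      rw [List.prod_cons, ← mul_assoc]
      have : afrW n k * afrW n k = 1 := Subtype.ext (afr_mul_self n k)
      rw [this, one_mul]
    · have hp' : Pos n' k' := by
        unfold Pos
        rw [← hc]
        lia
      obtain ⟨l', h1, h2, h3⟩ := ih n' k' hl' hp' (by
        rw [← hc]
        exact h)
      refine ⟨afrW m j :: l', ?_, by simpa using h2, ?_⟩
      · intro t ht
        rcases List.mem_cons.1 ht with rfl | ht
        · exact hl _ (by simp)
        · exact h1 t ht
      · rw [List.prod_cons, List.prod_cons, h3, ← mul_assoc, ← mul_assoc]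
        congr 1
        exact Subtype.ext hc'.symm


/-! ### The affine Weyl group is generated by the simple reflections -/

/-- The subgroup generated by the simple reflections. -/
def simpleSpan : Subgroup (affineWeyl datum) := Subgroup.closure (simpleReflections base)

theorem afrW_mul_self (n : Idx) (k : ℤ) : afrW n k * afrW n k = 1 := Subtype.ext (afr_mul_self n k)

/-- Conceptually, `2 = q n n` is the sum of the `n_j q n α_j` with all `n_j ≥ 0`; here it is checked
on the list of roots. -/
theorem exists_simple_q_pos (n : Idx) (h : 0 < n.1 ⬝ᵥ one) : ∃ j, 0 < q n.1 (simple j).1 := by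
  have : ∀ n ∈ roots, 0 < n ⬝ᵥ one → ∃ j, 0 < q n (simple j).1 := by decide +kernel
  exact this _ (mem_roots n) h

/-- Induction on height: reflecting in a simple root that pairs positively with `n` lowers the
height, stays positive unless `n` is that simple root, and conjugates the two reflections. -/
theorem afrW_mem_of_pos (N : ℕ) : ∀ n : Idx, 0 < n.1 ⬝ᵥ one → n.1 ⬝ᵥ one ≤ N →
    afrW n 0 ∈ simpleSpan := by
  induction N with
  | zero => intro n h h'; simp only [Nat.cast_zero] at h'; lia
  | succ N ih =>
    intro n h h'
    obtain ⟨j, hj⟩ := exists_simple_q_pos n h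
    have hs : afrW (simple j) 0 ∈ simpleSpan := Subgroup.subset_closure (simple_mem j)
    by_cases hn : n = simple j
    · rw [hn]; exact hs
    have h1 : (simple j).1 ⬝ᵥ one + 12 * 0 = 1 := by
      have : ∀ j, (simple j).1 ⬝ᵥ one + 12 * 0 = 1 := by decide
      exact this j
    have hpos : 0 < n.1 ⬝ᵥ ev 12 (afr (simple j) 0) one + 12 * 0 := by
      by_contra hc
      exact hn (eq_of_not_pos h1 (by unfold Pos; lia) (not_lt.1 hc)).1
    obtain ⟨n', k', hc, hc'⟩ := exists_comp (afr (simple j) 0) n 0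
    -- A linear reflection fixes the origin, so evaluating there shows that no constant term
    -- appears.
    have hk : k' = 0 := by
      have := hc 1 0
      rw [ev_afr] at this
      simpa using this.symm
    subst hk
    rw [hc] at hpos
    have hc2 := hc 12 one
    rw [ev_afr, h1, one_smul, dotProduct_sub, dotProduct_coroot] at hc2
    have hm := ih n' (by lia) (by push_cast at h'; lia)
    have : afrW n 0 = afrW (simple j) 0 * afrW n' 0 * afrW (simple j) 0 := by
      rw [show afrW (simple j) 0 * afrW n' 0 = afrW n 0 * afrW (simple j) 0 from
        Subtype.ext hc'.symm, mul_assoc, afrW_mul_self, mul_one]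
    rw [this]
    exact mul_mem (mul_mem hs hm) hs

theorem afrW_mem_simpleSpan (n : Idx) : afrW n 0 ∈ simpleSpan := by
  have hb := ht_bound n
  rcases lt_or_gt_of_ne hb.2.2 with h | h
  · have : afrW n 0 = afrW (opp n) 0 := Subtype.ext (afr_neg n (opp n) 0 rfl).symm
    rw [this]
    refine afrW_mem_of_pos 11 _ ?_ ?_
    all_goals
      simp only [opp, neg_dotProduct]
      push_cast
      lia
  · exact afrW_mem_of_pos 11 _ h (by push_cast; lia)

/-! ### Translations by coroots -/

theorem t_add (y z : L) : t datum (y + z) = t datum y * t datum z := by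
  simp only [t, ofAdd_add, map_mul]

/-- The translations in the subgroup generated by the simple reflections. -/
def translations : AddSubgroup L where
  carrier := {y | ∃ a ∈ simpleSpan, (a : ExtAffineWeyl datum) = t datum y}
  zero_mem' := ⟨1, one_mem _, rfl⟩
  add_mem' := by
    rintro y z ⟨a, ha, ha'⟩ ⟨b, hb, hb'⟩
    exact ⟨a * b, mul_mem ha hb, by rw [t_add, ← ha', ← hb']; rfl⟩
  neg_mem' := by
    rintro y ⟨a, ha, ha'⟩
    refine ⟨a⁻¹, inv_mem ha, ?_⟩
    rw [Subgroup.coe_inv, ha', inv_eq_iff_mul_eq_one, ← t_add, add_neg_cancel]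
    rfl

theorem fin_mul_t (w : W datum) (y : L) :
    fin datum w * t datum y = t datum ((w : L ≃ₗ[ℤ] L) y) * fin datum w := by
  refine SemidirectProduct.ext ?_ ?_
  · apply Multiplicative.toAdd.injective
    change (0 : L) + (w : L ≃ₗ[ℤ] L) y = (w : L ≃ₗ[ℤ] L) y + (0 : L)
    rw [zero_add, add_zero]
  · change w * 1 = 1 * w
    rw [mul_one, one_mul]

theorem afr_zero (n : Idx) : afr n 0 = fin datum (refl datum n) := by
  refine SemidirectProduct.ext ?_ rfl
  apply Multiplicative.toAdd.injective
  change -0 • _ = (0 : L)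
  simp

/-- The vector is `y - s_n(y)`, and conjugating `t_y` by `s_n` gives the translation by `s_n(y)`. -/
theorem smul_coroot_mem_translations {y : L} (hy : y ∈ translations) (n : Idx) :
    (n.1 ⬝ᵥ y) • (CartanMatrix.E₆ *ᵥ n.1) ∈ translations := by
  have h : y - (n.1 ⬝ᵥ y) • (CartanMatrix.E₆ *ᵥ n.1) ∈ translations := by
    obtain ⟨a, ha, ha'⟩ := hy
    refine ⟨afrW n 0 * a * (afrW n 0)⁻¹, mul_mem (mul_mem (afrW_mem_simpleSpan n) ha)
      (inv_mem (afrW_mem_simpleSpan n)), ?_⟩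
    simp only [Subgroup.coe_mul, Subgroup.coe_inv, ha']
    change afr n 0 * _ * (afr n 0)⁻¹ = _
    rw [afr_zero, fin_mul_t, refl_apply, mul_inv_cancel_right]
  have := sub_mem hy h
  rwa [sub_sub_cancel] at this

/-- The translation by the highest coroot is `s_0 s_θ`. As `θ` pairs to `1` with `α_2`, this gives
the coroot of `α_2`, and each edge of the Dynkin diagram then passes membership to a neighbour. -/
theorem simple_coroot_mem_translations (j : Fin 6) :
    CartanMatrix.E₆ *ᵥ (simple j).1 ∈ translations := by
  have h0 : CartanMatrix.E₆ *ᵥ theta.1 ∈ translations := by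
    refine ⟨afrW theta (-1) * afrW theta 0, mul_mem (Subgroup.subset_closure affine_simple_mem)
      (afrW_mem_simpleSpan _), ?_⟩
    change afr theta (-1) * afr theta 0 = _
    have h1 : afr theta (-1) = t datum (CartanMatrix.E₆ *ᵥ theta.1) * afr theta 0 := by
      rw [afr_zero]
      refine SemidirectProduct.ext ?_ ?_
      · apply Multiplicative.toAdd.injective
        change - -1 • (CartanMatrix.E₆ *ᵥ theta.1) = CartanMatrix.E₆ *ᵥ theta.1 + (0 : L)
        simp
      · change refl datum theta = 1 * refl datum theta
        rw [one_mul]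
    rw [h1, mul_assoc, afr_mul_self, mul_one]
  have step : ∀ {i j : Fin 6}, (simple j).1 ⬝ᵥ (CartanMatrix.E₆ *ᵥ (simple i).1) = -1 →
      CartanMatrix.E₆ *ᵥ (simple i).1 ∈ translations →
      CartanMatrix.E₆ *ᵥ (simple j).1 ∈ translations := by
    intro i j h hi
    have := smul_coroot_mem_translations hi (simple j)
    rw [h, neg_one_smul] at this
    exact neg_mem_iff.1 this
  have h1 : CartanMatrix.E₆ *ᵥ (simple 1).1 ∈ translations := by
    have := smul_coroot_mem_translations h0 (simple 1)
    rwa [show (simple 1).1 ⬝ᵥ (CartanMatrix.E₆ *ᵥ theta.1) = 1 by decide, one_smul] at this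
  have h3 := step (i := 1) (j := 3) (by decide) h1
  have h2 := step (i := 3) (j := 2) (by decide) h3
  have h4 := step (i := 3) (j := 4) (by decide) h3
  have h0 := step (i := 2) (j := 0) (by decide) h2
  have h5 := step (i := 4) (j := 5) (by decide) h4
  fin_cases j
  exacts [h0, h1, h2, h3, h4, h5]

theorem corootLattice_le : corootLattice datum ≤ translations := by
  refine (AddSubgroup.closure_le _).2 ?_
  rintro _ ⟨n, rfl⟩
  change CartanMatrix.E₆ *ᵥ n.1 ∈ translations
  have : CartanMatrix.E₆ *ᵥ n.1 = ∑ i, n.1 i • (CartanMatrix.E₆ *ᵥ (simple i).1) := by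
    have hn : n.1 = ∑ i, n.1 i • (simple i).1 := by
      ext j
      simp [simple, Pi.single_apply]
    conv_lhs => rw [hn]
    change CartanMatrix.E₆.mulVecLin _ = _
    rw [map_sum]
    simp only [map_smul, mulVecLin_apply]
  rw [this]
  exact sum_mem fun i _ => zsmul_mem (simple_coroot_mem_translations i) _

theorem fin_mem_simpleSpan (w : W datum) :
    ∃ a ∈ simpleSpan, (a : ExtAffineWeyl datum) = fin datum w := by
  obtain ⟨w, hw⟩ := w
  induction hw using Subgroup.closure_induction with
  | mem w hw =>
    obtain ⟨n, rfl⟩ := hw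
    exact ⟨afrW n 0, afrW_mem_simpleSpan n, afr_zero n⟩
  | one => exact ⟨1, one_mem _, rfl⟩
  | mul v w hv hw iv iw =>
    obtain ⟨a, ha, ha'⟩ := iv
    obtain ⟨b, hb, hb'⟩ := iw
    refine ⟨a * b, mul_mem ha hb, ?_⟩
    rw [Subgroup.coe_mul, ha', hb', ← map_mul]
    rfl
  | inv w hw iw =>
    obtain ⟨a, ha, ha'⟩ := iw
    refine ⟨a⁻¹, inv_mem ha, ?_⟩
    rw [Subgroup.coe_inv, ha', ← map_inv]
    rfl

theorem mem_simpleSpan (a : affineWeyl datum) : a ∈ simpleSpan := by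
  obtain ⟨b, hb, hb'⟩ := corootLattice_le a.2
  obtain ⟨c, hc, hc'⟩ := fin_mem_simpleSpan a.1.right
  have : a = b * c := by
    apply Subtype.ext
    rw [Subgroup.coe_mul, hb', hc']
    exact (SemidirectProduct.inl_left_mul_inr_right a.1).symm
  rw [this]
  exact mul_mem hb hc

theorem exists_list (a : affineWeyl datum) :
    ∃ l : List (affineWeyl datum), (∀ s ∈ l, s ∈ simpleReflections base) ∧ l.prod = a := by
  have ha : a ∈ simpleSpan.toSubmonoid := mem_simpleSpan a
  rw [simpleSpan, Subgroup.closure_toSubmonoid] at ha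
  obtain ⟨l, hl, hl'⟩ := Submonoid.exists_list_of_mem_closure ha
  -- The monoid generators include inverses of simple reflections; these are again simple
  -- reflections, being involutions.
  refine ⟨l, fun s hs => (hl s hs).elim id fun h => ?_, hl'⟩
  obtain ⟨n, k, -, hk⟩ := exists_of_mem_simpleReflections h
  have : s = s⁻¹ := by
    rw [eq_inv_iff_mul_eq_one, ← inv_inv s, hk, ← _root_.mul_inv_rev, afrW_mul_self, inv_one]
  rwa [this]

/-! ### Steps of the Bruhat order -/

/-- Strong exchange applied to a word of minimal length. Generation is needed first: otherwise the
infimum defining the length could be that of an empty set. -/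
theorem length_afrW_mul_lt (a : affineWeyl datum) {n : Idx} {k : ℤ} (hp : Pos n k)
    (h : n.1 ⬝ᵥ ev 12 a one + 12 * k < 0) :
    Bruhat.length (simpleReflections base) (afrW n k * a) <
      Bruhat.length (simpleReflections base) a := by
  have hne : {m : ℕ | ∃ l : List (affineWeyl datum), (∀ s ∈ l, s ∈ simpleReflections base) ∧
      l.prod = a ∧ l.length = m}.Nonempty := by
    obtain ⟨l, h1, h2⟩ := exists_list a
    exact ⟨_, l, h1, h2, rfl⟩
  obtain ⟨l, h1, h2, h3⟩ := Nat.sInf_mem hne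
  obtain ⟨l', h1', h2', h3'⟩ := strong_exchange l n k h1 hp (by rw [h2]; exact h)
  calc Bruhat.length (simpleReflections base) (afrW n k * a) ≤ l'.length :=
        Nat.sInf_le ⟨l', h1', by rw [h3', h2], rfl⟩
    _ < l.length := h2'
    _ = _ := h3

/-- A step up in the Bruhat order is a reflection in an affine root that is positive at the
base alcove and at the starting alcove. -/
theorem exists_of_step {a b s : affineWeyl datum}
    (hs : s ∈ Bruhat.reflections (simpleReflections base)) (hb : b = a * s)
    (hl : Bruhat.length (simpleReflections base) a < Bruhat.length (simpleReflections base) b) :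
    ∃ n k, Pos n k ∧ 0 < n.1 ⬝ᵥ ev 12 a one + 12 * k ∧ b = afrW n k * a := by
  obtain ⟨g, s, hs, rfl⟩ := hs
  obtain ⟨m, j, -, rfl⟩ := exists_of_mem_simpleReflections hs
  obtain ⟨n, k, -, hc⟩ := exists_comp (a * g : affineWeyl datum)⁻¹ m j
  have hb' : b = afrW n k * a := by
    rw [hb]
    apply Subtype.ext
    change (a : ExtAffineWeyl datum) * (g * afr m j * (g : ExtAffineWeyl datum)⁻¹) = afr n k * a
    rw [Subgroup.coe_mul, _root_.mul_inv_rev] at hc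
    have := congrArg (fun z => (a * g : ExtAffineWeyl datum) * z * (a : ExtAffineWeyl datum)) hc
    simp only [mul_assoc, mul_inv_cancel_left, inv_mul_cancel, mul_one]
      at this ⊢
    exact this
  -- Once the sign of the affine root is chosen so that it is positive on the base alcove, a
  -- negative value on the alcove of `a` would make `b` shorter than `a`.
  have main : ∀ n k, Pos n k → b = afrW n k * a →
      ∃ n k, Pos n k ∧ 0 < n.1 ⬝ᵥ ev 12 a one + 12 * k ∧ b = afrW n k * a := by
    intro n k hp hb'
    refine ⟨n, k, hp, ?_, hb'⟩
    by_contra hneg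
    have h0 : n.1 ⬝ᵥ ev 12 a one + 12 * k ≠ 0 := by
      obtain ⟨n', k', h, -⟩ := exists_comp a n k
      rw [h]
      exact val_ne_zero _ _
    have := length_afrW_mul_lt a hp (by lia)
    rw [← hb'] at this
    lia
  rcases lt_or_gt_of_ne (val_ne_zero n k) with h | h
  · refine main (opp n) (-k) ?_ ?_
    · unfold Pos
      simp only [opp, neg_dotProduct]
      lia
    · rw [hb']
      congr 1
      exact Subtype.ext (afr_neg n (opp n) k rfl).symm
  · exact main n k h hb'


/-! ### Affine roots on the base alcove -/

theorem root'_apply (n : Idx) (y : L) : datum.root' n y = n.1 ⬝ᵥ y := rfl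

theorem pair_eq_sum (n : Idx) (v : V L) :
    pair datum n v = ∑ i, (n.1 i : ℝ) * pair datum (simple i) v := by
  induction v using TensorProduct.induction_on with
  | zero => simp
  | tmul r y =>
    simp only [pair_tmul, root'_apply]
    have : ∀ i, (simple i).1 ⬝ᵥ y = y i := fun i => by simp [simple]
    simp only [this]
    simp only [dotProduct]
    push_cast
    rw [Finset.mul_sum]
    exact Finset.sum_congr rfl fun i _ => by ring
  | add v w hv hw =>
    simp only [map_add, mul_add, Finset.sum_add_distrib]
    rw [hv, hw]

theorem pair_act {g : ExtAffineWeyl datum} {n n' : Idx} {k k' : ℤ}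
    (h : ∀ N z, n.1 ⬝ᵥ ev N g z + N * k = n'.1 ⬝ᵥ z + N * k') (v : V L) :
    pair datum n (act datum g v) + k = pair datum n' v + k' := by
  -- Scale `0` isolates the linear part of the identity; scale `1` at the origin then gives its
  -- constant term.
  have h0 : ∀ z, n.1 ⬝ᵥ (g.right : L ≃ₗ[ℤ] L) z = n'.1 ⬝ᵥ z := fun z => by
    simpa [ev] using h 0 z
  have h1 : n.1 ⬝ᵥ (g.left.toAdd : L) + k = k' := by simpa [ev] using h 1 0
  have h2 : pair datum n ((((g.right : L ≃ₗ[ℤ] L) : L →ₗ[ℤ] L).baseChange ℝ) v)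
      = pair datum n' v := by
    induction v using TensorProduct.induction_on with
    | zero => simp
    | tmul r y =>
      rw [LinearMap.baseChange_tmul, pair_tmul, pair_tmul, root'_apply, root'_apply]
      congr 2
      exact h0 y
    | add v w hv hw => rw [map_add, map_add, map_add, hv, hw]
  change pair datum n (_ + _) + (k : ℝ) = _
  rw [map_add, pair_tmul, h2, root'_apply, ← h1]
  push_cast
  ring

theorem mem_alcove_iff (v : V L) : v ∈ alcove base ↔
    (∀ i, 0 < pair datum (simple i) v) ∧ pair datum theta v < 1 := by
  constructor
  · intro h
    refine ⟨fun i => h.1 _ ?_, h.2 _ ((isHighest_iff _).2 rfl)⟩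
    change simple i ∈ (base.support : Set Idx)
    rw [support_base]
    exact ⟨i, rfl⟩
  · intro h
    refine ⟨fun i hi => ?_, fun θ hθ => ?_⟩
    · have hi' : i ∈ Set.range simple := by rw [← support_base]; exact hi
      obtain ⟨j, rfl⟩ := hi'
      exact h.1 j
    · rw [(isHighest_iff _).1 hθ]
      exact h.2

/-- The barycentre of the base alcove. -/
def barycentre : V L := (1 / 12 : ℝ) ⊗ₜ[ℤ] one

theorem pair_barycentre (n : Idx) (k : ℤ) :
    pair datum n barycentre + k = ((n.1 ⬝ᵥ one + 12 * k : ℤ) : ℝ) / 12 := by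
  rw [barycentre, pair_tmul, root'_apply]
  push_cast
  ring

theorem barycentre_mem : barycentre ∈ alcove base := by
  rw [mem_alcove_iff]
  constructor
  · intro i
    have h := pair_barycentre (simple i) 0
    have h1 : (simple i).1 ⬝ᵥ one + 12 * 0 = 1 := by
      have : ∀ j, (simple j).1 ⬝ᵥ one + 12 * 0 = 1 := by decide
      exact this i
    rw [h1] at h
    norm_num at h
    rw [h]
    norm_num
  · have h := pair_barycentre theta 0
    rw [show theta.1 ⬝ᵥ one + 12 * 0 = 11 by decide] at h
    norm_num at h
    rw [h]
    norm_num

/-- The sign at the barycentre decides the sign on the whole alcove: for `k = 0` the root is a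
nonnegative sum of simple roots, and for `k ≥ 1` it exceeds `-1` on the alcove because it is at
least `-θ` there. -/
theorem Pos.pos_of_mem_alcove {n : Idx} {k : ℤ} (h : Pos n k) {v : V L}
    (hv : v ∈ alcove base) : 0 < pair datum n v + k := by
  rw [mem_alcove_iff] at hv
  obtain ⟨h1, h2⟩ := hv
  have hk := h.nonneg
  rcases hk.eq_or_lt with h0 | h0
  · have hn := h.nonneg_coeff h0.symm
    subst h0
    rw [pair_eq_sum, Int.cast_zero, add_zero]
    obtain ⟨i, hi⟩ : ∃ i, 0 < n.1 i := by
      by_contra! hc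
      have : n.1 = 0 := funext fun i => le_antisymm (hc i) (hn i)
      have hb := ht_bound n
      rw [this] at hb
      simp at hb
    exact Finset.sum_pos' (fun i _ => mul_nonneg (by exact_mod_cast hn i) (h1 i).le)
      ⟨i, Finset.mem_univ _, mul_pos (by exact_mod_cast hi) (h1 i)⟩
  · have h3 : -pair datum theta v ≤ pair datum n v := by
      rw [pair_eq_sum, pair_eq_sum n, ← Finset.sum_neg_distrib]
      refine Finset.sum_le_sum fun i _ => ?_
      rw [← neg_mul]
      refine mul_le_mul_of_nonneg_right ?_ (h1 i).le
      exact_mod_cast neg_theta_le n i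
    have h4 : (1 : ℝ) ≤ k := by exact_mod_cast h0
    linarith

/-- Elements of the stabilizer of the alcove preserve the positive affine roots. -/
theorem Pos.comp_stab {n n' : Idx} {k k' : ℤ} (hp : Pos n k) {ω : ExtAffineWeyl datum}
    (hω : ω ∈ stab base)
    (h : ∀ N z, n.1 ⬝ᵥ ev N ω z + N * k = n'.1 ⬝ᵥ z + N * k') : Pos n' k' := by
  have hb : act datum ω barycentre ∈ alcove base := by
    rw [← show act datum ω '' alcove base = alcove base from hω]
    exact ⟨_, barycentre_mem, rfl⟩
  have h1 := hp.pos_of_mem_alcove hb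
  rw [pair_act h, pair_barycentre] at h1
  unfold Pos
  have h2 : (0 : ℝ) < ((n'.1 ⬝ᵥ one + 12 * k' : ℤ) : ℝ) := by linarith
  exact_mod_cast h2

theorem act_mem_alcove {ω : ExtAffineWeyl datum} (hω : ev 12 ω one = one) {v : V L}
    (hv : v ∈ alcove base) : act datum ω v ∈ alcove base := by
  have key : ∀ n k, Pos n k → 0 < pair datum n (act datum ω v) + k := by
    intro n k hp
    obtain ⟨n', k', h, -⟩ := exists_comp ω n k
    rw [pair_act h]
    refine Pos.pos_of_mem_alcove ?_ hv
    unfold Pos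
    rw [← h, hω]
    exact hp
  rw [mem_alcove_iff]
  constructor
  · intro i
    have h1 : ∀ j, 0 < (simple j).1 ⬝ᵥ one + 12 * 0 := by decide
    simpa using key (simple i) 0 (h1 i)
  · have h := key (opp theta) 1 (by unfold Pos; decide)
    have : pair datum (opp theta) (act datum ω v) = - pair datum theta (act datum ω v) := by
      rw [pair_eq_sum, pair_eq_sum theta, ← Finset.sum_neg_distrib]
      refine Finset.sum_congr rfl fun i _ => ?_
      simp [opp]
    rw [this] at h
    push_cast at h
    linarith

/-- An element fixing the barycentre stabilizes the alcove. -/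
theorem mem_stab {ω : ExtAffineWeyl datum} (hω : ev 12 ω one = one) : ω ∈ stab base := by
  have hω' : ev 12 ω⁻¹ one = one := by
    conv_lhs => rw [← hω]
    rw [← ev_mul, inv_mul_cancel, ev_one]
  refine Set.Subset.antisymm ?_ ?_
  · rintro _ ⟨v, hv, rfl⟩
    exact act_mem_alcove hω hv
  · intro v hv
    refine ⟨act datum ω⁻¹ v, act_mem_alcove hω' hv, ?_⟩
    rw [← act_mul, mul_inv_cancel, act_one]

/-! ### An obstruction to admissibility -/

theorem dotProduct_rho (n : L) (i : Fin 6) : n ⬝ᵥ rho i = n i := by simp [rho]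

/-- This is three times the value of the affine root at the vertex `ρ₄ / 3`; the vertex lies on the
boundary, so only weak positivity survives. -/
theorem Pos.nonneg_vertex {n : Idx} {k : ℤ} (h : Pos n k) : 0 ≤ n.1 3 + 3 * k := by
  rcases h.nonneg.eq_or_lt with h0 | h0
  · have := h.nonneg_coeff h0.symm 3
    lia
  · have := neg_theta_le n 3
    rw [show theta.1 3 = 3 from rfl] at this
    lia

/-- Three times the displacement of the vertex `ρ₄ / 3` of the base alcove. -/
def disp (g : ExtAffineWeyl datum) : L := ev 3 g (rho 3) - rho 3

/-- Displacements that are too long or belong to `U`. -/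
def Bad (U : List L) (d : L) : Prop := d ∈ U ∨ ∃ m : Idx, 3 < m.1 ⬝ᵥ d

/-- Sufficient conditions for `Bad U` to be stable under upward steps in the Bruhat order and to
exclude the translations by minuscule coweights. -/
structure Closed (U : List L) : Prop where
  bound : ∀ d ∈ U, ∀ n ∈ roots, -8 ≤ n ⬝ᵥ d
  not_dvd : ∀ d ∈ U, ¬ 3 ∣ d 3
  step : ∀ d ∈ U, ∀ n ∈ roots, ∀ k ∈ [(0 : ℤ), 1, 2], 0 < n ⬝ᵥ one + 12 * k →
    0 < n ⬝ᵥ d + (n 3 + 3 * k) →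
    (d - (n ⬝ᵥ d + (n 3 + 3 * k)) • (CartanMatrix.E₆ *ᵥ n)) ∈ U ∨
    ∃ m ∈ roots, 3 < m ⬝ᵥ (d - (n ⬝ᵥ d + (n 3 + 3 * k)) • (CartanMatrix.E₆ *ᵥ n))

theorem q_roots : ∀ m ∈ roots, q m m = 2 := by decide +kernel

theorem Bad.step {U : List L} (hU : Closed U) {d : L} (hd : Bad U d) {n : Idx} {k : ℤ}
    (hp : Pos n k) (h : 0 ≤ n.1 ⬝ᵥ d + (n.1 3 + 3 * k)) :
    Bad U (d - (n.1 ⬝ᵥ d + (n.1 3 + 3 * k)) • (CartanMatrix.E₆ *ᵥ n.1)) := by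
  have h3 := hp.nonneg_vertex
  rcases hd with hd | ⟨m, hm⟩
  · rcases h.eq_or_lt with h0 | h0
    · rw [← h0, zero_smul, sub_zero]
      exact Or.inl hd
    by_cases hk : k ≤ 2
    · have hk' : k ∈ [(0 : ℤ), 1, 2] := by
        have := hp.nonneg
        simp only [List.mem_cons, List.not_mem_nil, or_false]
        lia
      refine (hU.step d hd n.1 (mem_roots n) k hk' hp h0).imp id ?_
      rintro ⟨m, hm, hm'⟩
      exact ⟨⟨m, q_roots m hm⟩, hm'⟩
    · right
      refine ⟨opp n, ?_⟩
      -- For `k ≥ 3` the root `-n` detects length: its pairing with the new vector is `n·d + 2(n_4 +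
      -- 3k)`, which is at least `-8 + 2(-3 + 9) = 4`. This is why checking `k = 0, 1, 2` suffices.
      have h1 := hU.bound d hd n.1 (mem_roots n)
      have h2 := neg_theta_le n 3
      have h4 : q n.1 n.1 = 2 := n.2
      rw [show theta.1 3 = 3 from rfl] at h2
      change 3 < (-n.1) ⬝ᵥ _
      rw [dotProduct_sub, dotProduct_smul, neg_dotProduct, neg_dotProduct, dotProduct_coroot, h4]
      simp only [smul_eq_mul]
      lia
  · right
    -- If `q m n ≤ 0`, subtracting a nonnegative multiple of the coroot of `n` cannot lower the
    -- pairing with `m`. Otherwise `s_n(m)` works: its pairing with the new vector is `m·d + (n_4 +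
    -- 3k) q m n`, by nonnegativity at the vertex.
    rcases le_or_gt (q m.1 n.1) 0 with h0 | h0
    · refine ⟨m, ?_⟩
      rw [dotProduct_sub, dotProduct_smul, dotProduct_coroot, smul_eq_mul]
      nlinarith
    · refine ⟨reflPerm n m, ?_⟩
      have h4 : q n.1 n.1 = 2 := n.2
      rw [reflPerm_dotProduct, coreflection_apply, dotProduct_sub, dotProduct_sub,
        dotProduct_smul, dotProduct_smul, dotProduct_sub, dotProduct_smul]
      simp only [dotProduct_coroot, h4, smul_eq_mul]
      nlinarith [mul_nonneg h3 h0.le]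

theorem disp_afr_mul (g : ExtAffineWeyl datum) (n : Idx) (k : ℤ) :
    disp (afr n k * g) = disp g -
      (n.1 ⬝ᵥ disp g + (n.1 3 + 3 * k)) • (CartanMatrix.E₆ *ᵥ n.1) := by
  have : n.1 ⬝ᵥ disp g = n.1 ⬝ᵥ ev 3 g (rho 3) - n.1 3 := by
    rw [disp, dotProduct_sub, dotProduct_rho]
  rw [this, disp, ev_mul, ev_afr, disp, sub_right_comm]
  congr 2
  ring

theorem Bad.of_le {U : List L} (hU : Closed U) {y y' : affineWeyl datum}
    {ω : ExtAffineWeyl datum} (hω : ω ∈ stab base)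
    (h : Bruhat.le (simpleReflections base) y y') (hb : Bad U (disp (y * ω))) :
    Bad U (disp (y' * ω)) := by
  induction h with
  | refl => exact hb
  | @tail a _ _ hs ih =>
    obtain ⟨s, hs, hb, hl⟩ := hs
    obtain ⟨n, k, hp, hpos, rfl⟩ := exists_of_step hs hb hl
    rw [Subgroup.coe_mul, show (afrW n k : ExtAffineWeyl datum) = afr n k from rfl, mul_assoc,
      disp_afr_mul]
    refine ih.step hU hp ?_
    -- The affine root is pulled back through `a` and then `ω`. It stays positive on the base
    -- alcove, hence is nonnegative at its vertex, which says that the original root is nonnegative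
    -- at the moved vertex.
    obtain ⟨n₁, k₁, h₁, -⟩ := exists_comp a n k
    obtain ⟨n₂, k₂, h₂, -⟩ := exists_comp ω n₁ k₁
    have hp₁ : Pos n₁ k₁ := by
      unfold Pos
      rwa [← h₁]
    have hp₂ := (hp₁.comp_stab hω h₂).nonneg_vertex
    have h3 := h₁ 3 (ev 3 ω (rho 3))
    rw [h₂, ← ev_mul, dotProduct_rho] at h3
    rw [disp, dotProduct_sub, dotProduct_rho]
    linarith

theorem IsMinuscule.smul {μ : L} (h : IsMinuscule datum μ) (w : W datum) :
    IsMinuscule datum ((w : L ≃ₗ[ℤ] L) μ) := by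
  intro n
  obtain ⟨n', hn, -⟩ := exists_root_comp w n
  rw [root'_apply, hn]
  exact h n'

theorem not_mem_Adm {U : List L} (hU : Closed U) {g : ExtAffineWeyl datum} (hg : disp g ∈ U)
    {μ : L} (hμ : IsMinuscule datum μ) : g ∉ Adm base μ := by
  rintro ⟨w, y, y', ω, hω, rfl, h, hle⟩
  have hb := Bad.of_le hU hω hle (Or.inl hg)
  rw [← h] at hb
  have hd : disp (t datum ((w : L ≃ₗ[ℤ] L) μ)) = (3 : ℤ) • (w : L ≃ₗ[ℤ] L) μ := by
    change (3 : ℤ) • (w : L ≃ₗ[ℤ] L) μ + rho 3 - rho 3 = _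
    rw [add_sub_cancel_right]
  rw [hd] at hb
  rcases hb with hb | ⟨m, hm⟩
  · exact hU.not_dvd _ hb ⟨(w : L ≃ₗ[ℤ] L) μ 3, rfl⟩
  · rw [dotProduct_smul] at hm
    have := IsMinuscule.smul hμ w m
    rw [root'_apply] at this
    simp only [smul_eq_mul] at hm
    lia


/-! ### Words in the simple reflections -/

/-- The product of a word in the simple reflections. -/
def word (l : List (Fin 6)) : W datum := (l.map s).prod

/-- The action of a word on the coweight lattice, in coordinates. -/
def wordAct (l : List (Fin 6)) (v : L) : L :=
  l.foldr (fun i v => v - v i • (CartanMatrix.E₆ *ᵥ Pi.single i 1)) v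

theorem s_apply (i : Fin 6) (v : L) : ((s i : W datum) : L ≃ₗ[ℤ] L) v =
    v - v i • (CartanMatrix.E₆ *ᵥ Pi.single i 1) := by
  rw [s, refl_apply]
  simp [simple]

theorem word_apply (l : List (Fin 6)) (v : L) :
    ((word l : W datum) : L ≃ₗ[ℤ] L) v = wordAct l v := by
  induction l with
  | nil => rfl
  | cons i l ih =>
    change ((s i : W datum) : L ≃ₗ[ℤ] L) (((word l : W datum) : L ≃ₗ[ℤ] L) v) = _
    rw [ih, s_apply]
    rfl

theorem s_inv (i : Fin 6) : (s i)⁻¹ = s i :=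
  Subtype.ext (datum.coreflection_inv (simple i))

theorem word_inv (l : List (Fin 6)) : (word l)⁻¹ = word l.reverse := by
  rw [word, word, List.prod_inv_reverse, List.map_map, ← List.map_reverse]
  exact congrArg List.prod (List.map_congr_left fun i _ => s_inv i)

/-- The element `w t_μ w'⁻¹`, where `w` and `w'` are the products of the words `u` and `v`. -/
def elt (u v : List (Fin 6)) (μ : L) : ExtAffineWeyl datum :=
  ⟨Multiplicative.ofAdd (wordAct u μ), word (u ++ v.reverse)⟩

theorem elt_eq (u v : List (Fin 6)) (μ : L) :
    fin datum (word u) * t datum μ * (fin datum (word v))⁻¹ = elt u v μ := by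
  rw [fin_mul_t, mul_assoc, ← map_inv, ← map_mul, word_inv, word_apply, elt,
    SemidirectProduct.mk_eq_inl_mul_inr]
  simp only [word, List.map_append, List.prod_append]
  rfl

theorem disp_elt (u v : List (Fin 6)) (μ : L) :
    disp (elt u v μ) = (3 : ℤ) • wordAct u μ + wordAct (u ++ v.reverse) (rho 3) - rho 3 := by
  rw [← word_apply (u ++ v.reverse)]
  rfl

/-! ### A criterion for permissibility -/

theorem smul_sub_mem_corootLattice (w : W datum) : ∀ y : L,
    (w : L ≃ₗ[ℤ] L) y - y ∈ corootLattice datum := by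
  obtain ⟨w, hw⟩ := w
  change ∀ y : L, w y - y ∈ corootLattice datum
  have key : ∀ n : Idx, ∀ y : L, datum.coreflection n y - y ∈ corootLattice datum := by
    intro n y
    rw [coreflection_apply, sub_sub_cancel_left]
    exact neg_mem (zsmul_mem (AddSubgroup.subset_closure
      (Set.mem_range_self (f := datum.coroot) n)) _)
  induction hw using Subgroup.closure_induction'' with
  | mem w hw =>
    obtain ⟨i, rfl⟩ := hw
    exact key i
  | inv_mem w hw =>
    obtain ⟨i, rfl⟩ := hw
    have : (datum.coreflection i)⁻¹ = datum.coreflection i := datum.coreflection_inv i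
    rw [this]
    exact key i
  | one => intro y; change y - y ∈ _; rw [sub_self]; exact zero_mem _
  | mul a b _ _ ha hb =>
    intro y
    have := add_mem (ha (b y)) (hb y)
    rwa [sub_add_sub_cancel] at this

/-- The Weyl group acts trivially on coweights modulo coroots, so the class of the translation part
determines the coset of the affine Weyl group. -/
theorem mul_inv_mem_affineWeyl {g h : ExtAffineWeyl datum}
    (hgh : (g.left.toAdd : L) - h.left.toAdd ∈ corootLattice datum) :
    g * h⁻¹ ∈ affineWeyl datum := by
  have h1 := smul_sub_mem_corootLattice (g.right * h.right⁻¹) h.left.toAdd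
  have h2 := sub_mem hgh h1
  rw [sub_sub_sub_cancel_right] at h2
  have e : ((g * h⁻¹).left.toAdd : L) = (g.left.toAdd : L) -
      ((g.right * h.right⁻¹ : W datum) : L ≃ₗ[ℤ] L) h.left.toAdd := by
    change (g.left.toAdd : L) + (g.right : L ≃ₗ[ℤ] L)
      (((h.right⁻¹ : W datum) : L ≃ₗ[ℤ] L) (-(h.left.toAdd : L))) = _
    rw [map_neg, map_neg, ← sub_eq_add_neg]
    rfl
  change ((g * h⁻¹).left.toAdd : L) ∈ corootLattice datum
  rw [e]
  exact h2

theorem le_of_mem_closedAlcove {v : V L} (hv : v ∈ closedAlcove base) :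
    (∀ i, 0 ≤ pair datum (simple i) v) ∧ pair datum theta v ≤ 1 := by
  let _ : TopologicalSpace (V L) := moduleTopology ℝ (V L)
  have : IsModuleTopology ℝ (V L) := ⟨rfl⟩
  have hc : ∀ n, Continuous (pair datum n) := fun n => IsModuleTopology.continuous_of_linearMap _
  have hcl : IsClosed {v : V L | (∀ i, 0 ≤ pair datum (simple i) v) ∧ pair datum theta v ≤ 1} := by
    rw [Set.ofPred_and, Set.ofPred_forall]
    exact (isClosed_iInter fun i => isClosed_le continuous_const (hc _)).inter
      (isClosed_le (hc _) continuous_const)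
  refine closure_minimal (fun v hv => ?_) hcl hv
  rw [mem_alcove_iff] at hv
  exact ⟨fun i => (hv.1 i).le, hv.2.le⟩

theorem eq_sum_rho (v : V L) : v = ∑ i, pair datum (simple i) v • ((1 : ℝ) ⊗ₜ[ℤ] rho i : V L) := by
  induction v using TensorProduct.induction_on with
  | zero => simp
  | tmul r y =>
    have h : ∀ i, pair datum (simple i) (r ⊗ₜ[ℤ] y) • ((1 : ℝ) ⊗ₜ[ℤ] rho i : V L) =
        r ⊗ₜ[ℤ] (y i • rho i) := fun i => by
      have : (simple i).1 ⬝ᵥ y = y i := by simp [simple]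
      rw [pair_tmul, root'_apply, this, TensorProduct.tmul_smul, TensorProduct.smul_tmul',
        TensorProduct.smul_tmul']
      congr 1
      simp [mul_comm]
    simp only [h, ← TensorProduct.tmul_sum]
    congr 1
    ext j
    simp [rho, Pi.single_apply]
  | add v w hv hw =>
    simp only [map_add, add_smul, Finset.sum_add_distrib]
    rw [← hv, ← hw]

/-- A convex set that contains all members of a list contains their average. -/
theorem average_mem {E : Type*} [AddCommGroup E] [Module ℝ E] {K : Set E} (hK : Convex ℝ K)
    {l : List E} (hl : ∀ z ∈ l, z ∈ K) (h0 : 0 < l.length) : (l.length : ℝ)⁻¹ • l.sum ∈ K := by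
  have h0' : (l.length : ℝ) ≠ 0 := by positivity
  have : (l.length : ℝ)⁻¹ • l.sum = ∑ i : Fin l.length, (l.length : ℝ)⁻¹ • l[i] := by
    rw [← Finset.smul_sum]
    exact congrArg _ (Fin.sum_univ_getElem l).symm
  rw [this]
  exact hK.sum_mem (fun _ _ => by positivity) (by simp [h0']) fun i _ => hl _ (by simp)

theorem mem_hull (w : W datum) (μ : L) :
    ((1 : ℝ) ⊗ₜ[ℤ] (w : L ≃ₗ[ℤ] L) μ : V L) ∈ hull datum μ :=
  subset_convexHull _ _ ⟨w, rfl⟩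

/-- Permissibility follows if the displacements of the vertices of the base alcove are averages
of orbit elements. -/
theorem mem_Perm {μ : L} {g ω : ExtAffineWeyl datum} (hω : ev 12 ω one = one)
    (hωμ : (ω.left.toAdd : L) = μ) {w : W datum}
    (hw : (g.left.toAdd : L) = (w : L ≃ₗ[ℤ] L) μ) (c : Fin 6 → List (List (Fin 6)))
    (hlen : ∀ i, ((c i).length : ℤ) = theta.1 i)
    (hsum : ∀ i, ((c i).map fun l => wordAct l μ).sum =
      (g.right : L ≃ₗ[ℤ] L) (rho i) - rho i + theta.1 i • (g.left.toAdd : L)) :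
    g ∈ Perm base μ := by
  refine ⟨⟨⟨g * ω⁻¹, mul_inv_mem_affineWeyl ?_⟩, ⟨t datum μ * ω⁻¹, mul_inv_mem_affineWeyl ?_⟩, ω,
    mem_stab hω, ?_, ?_⟩, fun v hv => ?_⟩
  · rw [hw, hωμ]
    exact smul_sub_mem_corootLattice w μ
  · rw [hωμ]
    change μ - μ ∈ corootLattice datum
    rw [sub_self]
    exact zero_mem _
  · rw [inv_mul_cancel_right]
  · rw [inv_mul_cancel_right]
  obtain ⟨h0, h1⟩ := le_of_mem_closedAlcove hv
  rw [pair_eq_sum] at h1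
  have hθ : ∀ i, 0 < theta.1 i := by decide
  have hK : Convex ℝ (hull datum μ) := convex_convexHull ℝ _
  -- `none` stands for the vertex `0` and `some i` for `ρ_i / θ_i`: `p` lists the vertex
  -- displacements and `a` the barycentric coordinates of `v`.
  let p : Option (Fin 6) → V L := fun o => o.elim ((1 : ℝ) ⊗ₜ[ℤ] (g.left.toAdd : L))
    fun i => (theta.1 i : ℝ)⁻¹ • ((1 : ℝ) ⊗ₜ[ℤ]
      ((g.right : L ≃ₗ[ℤ] L) (rho i) - rho i + theta.1 i • (g.left.toAdd : L)))
  let a : Option (Fin 6) → ℝ := fun o => o.elim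
    (1 - ∑ i, (theta.1 i : ℝ) * pair datum (simple i) v)
    fun i => (theta.1 i : ℝ) * pair datum (simple i) v
  have hp : ∀ o, p o ∈ hull datum μ := by
    rintro (_ | i)
    · change (1 : ℝ) ⊗ₜ[ℤ] (g.left.toAdd : L) ∈ _
      rw [hw]
      exact mem_hull w μ
    · change (theta.1 i : ℝ)⁻¹ • ((1 : ℝ) ⊗ₜ[ℤ] _) ∈ _
      have h2 := average_mem hK
        (l := (c i).map fun l => ((1 : ℝ) ⊗ₜ[ℤ] wordAct l μ : V L)) (fun z hz => by
          obtain ⟨l, -, rfl⟩ := List.mem_map.1 hz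
          rw [← word_apply]
          exact mem_hull _ _) (by
          rw [List.length_map]
          have := hlen i
          have := hθ i
          lia)
      have h3 : ((c i).map fun l => ((1 : ℝ) ⊗ₜ[ℤ] wordAct l μ : V L)).sum =
          (1 : ℝ) ⊗ₜ[ℤ] ((c i).map fun l => wordAct l μ).sum := by
        have := map_list_sum (TensorProduct.mk ℤ ℝ L 1) ((c i).map fun l => wordAct l μ)
        rw [List.map_map] at this
        exact this.symm
      rw [h3, hsum, List.length_map] at h2
      have h4 : ((c i).length : ℝ) = (theta.1 i : ℝ) := by
        rw [← hlen i]
        simp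
      rwa [h4] at h2
  have ha : ∀ o, 0 ≤ a o := by
    rintro (_ | i)
    · exact sub_nonneg.2 h1
    · exact mul_nonneg (by exact_mod_cast (hθ i).le) (h0 i)
  have ha1 : ∑ o, a o = 1 := by
    rw [Fintype.sum_option]
    exact sub_add_cancel _ _
  have key : act datum g v - v = ∑ o, a o • p o := by
    rw [Fintype.sum_option]
    change _ = (1 - ∑ i, (theta.1 i : ℝ) * pair datum (simple i) v) •
        ((1 : ℝ) ⊗ₜ[ℤ] (g.left.toAdd : L)) +
      ∑ i, ((theta.1 i : ℝ) * pair datum (simple i) v) • ((theta.1 i : ℝ)⁻¹ • ((1 : ℝ) ⊗ₜ[ℤ]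
        ((g.right : L ≃ₗ[ℤ] L) (rho i) - rho i + theta.1 i • (g.left.toAdd : L))))
    have h5 : ∀ i, ((theta.1 i : ℝ) * pair datum (simple i) v) • ((theta.1 i : ℝ)⁻¹ • (
        (1 : ℝ) ⊗ₜ[ℤ] ((g.right : L ≃ₗ[ℤ] L) (rho i) - rho i + theta.1 i • (g.left.toAdd : L)) :
          V L)) = pair datum (simple i) v • ((1 : ℝ) ⊗ₜ[ℤ] (g.right : L ≃ₗ[ℤ] L) (rho i))
          - pair datum (simple i) v • ((1 : ℝ) ⊗ₜ[ℤ] rho i) +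
          ((theta.1 i : ℝ) * pair datum (simple i) v) • ((1 : ℝ) ⊗ₜ[ℤ] (g.left.toAdd : L)) := by
      intro i
      have h6 : (theta.1 i : ℝ) ≠ 0 := by exact_mod_cast (hθ i).ne'
      rw [smul_smul, mul_right_comm, mul_inv_cancel₀ h6, one_mul, TensorProduct.tmul_add,
        TensorProduct.tmul_sub, TensorProduct.tmul_smul, ← Int.cast_smul_eq_zsmul ℝ]
      module
    simp only [h5]
    rw [Finset.sum_add_distrib, Finset.sum_sub_distrib, ← Finset.sum_smul, ← eq_sum_rho v]
    have h7 : ((g.right : L ≃ₗ[ℤ] L) : L →ₗ[ℤ] L).baseChange ℝ v =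
        ∑ i, pair datum (simple i) v • ((1 : ℝ) ⊗ₜ[ℤ] (g.right : L ≃ₗ[ℤ] L) (rho i) : V L) := by
      conv_lhs => rw [eq_sum_rho v]
      simp only [map_sum, map_smul, LinearMap.baseChange_tmul]
      rfl
    rw [← h7, act]
    module
  rw [key]
  exact hK.sum_mem (fun o _ => ha o) ha1 fun o _ => hp o

/-- Reduces permissibility to integer identities. The word `r` makes `t_μ r` fix the barycentre,
which identifies the `Ω`-component; the words in `c` name the orbit elements to be averaged. -/
theorem elt_mem_Perm {μ : L} (u v r : List (Fin 6)) (c : Fin 6 → List (List (Fin 6)))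
    (hr : (12 : ℤ) • μ + wordAct r one = one)
    (hlen : ∀ i, ((c i).length : ℤ) = theta.1 i)
    (hsum : ∀ i, ((c i).map fun l => wordAct l μ).sum =
      wordAct (u ++ v.reverse) (rho i) - rho i + theta.1 i • wordAct u μ) :
    elt u v μ ∈ Perm base μ := by
  refine mem_Perm (ω := ⟨Multiplicative.ofAdd μ, word r⟩) (w := word u) ?_ rfl
    (word_apply u μ).symm c hlen fun i => ?_
  · change (12 : ℤ) • μ + ((word r : W datum) : L ≃ₗ[ℤ] L) one = one
    rw [word_apply, hr]
  · rw [hsum, ← word_apply (u ++ _)]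
    rfl


/-! ### The permissible elements that are not admissible -/

theorem isMinuscule_of_forall {μ : L}
    (h : ∀ n ∈ roots, n ⬝ᵥ μ = -1 ∨ n ⬝ᵥ μ = 0 ∨ n ⬝ᵥ μ = 1) : IsMinuscule datum μ :=
  fun n => h _ (mem_roots n)

theorem isMinuscule_rho_zero : IsMinuscule datum (rho 0) :=
  isMinuscule_of_forall (by decide +kernel)

theorem isMinuscule_rho_five : IsMinuscule datum (rho 5) :=
  isMinuscule_of_forall (by decide +kernel)

theorem x_eq : x = elt [3, 4, 5, 1, 3, 4] [1, 3, 4, 5, 2, 3, 4, 1, 3, 2, 0] (rho 0) := by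
  rw [← elt_eq]
  simp only [x, w₁, w₂, word, List.map_cons, List.map_nil, List.prod_cons, List.prod_nil, mul_one,
    mul_assoc]

/-- The image of `x` under the automorphism of the Dynkin diagram. -/
def x' : ExtAffineWeyl datum :=
  elt [3, 2, 0, 1, 3, 2] [1, 3, 2, 0, 4, 3, 2, 1, 3, 4, 5] (rho 5)

/-- One of these vectors is the tripled displacement of `x`; nontrivial upward reflections either
permute among the three or produce a long vector. -/
theorem closed_zero : Closed [![3, 0, -3, 1, 0, 0], ![-3, 0, 0, 1, 0, 0], ![0, 0, 3, -2, 0, 0]] where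
  bound := by decide +kernel
  not_dvd := by decide +kernel
  step := by decide +kernel

theorem closed_five : Closed [![0, 0, 0, 1, -3, 3], ![0, 0, 0, 1, 0, -3], ![0, 0, 0, -2, 3, 0]] where
  bound := by decide +kernel
  not_dvd := by decide +kernel
  step := by decide +kernel

theorem x_not_mem_Adm : x ∉ Adm base (rho 0) := by
  refine not_mem_Adm closed_zero ?_ isMinuscule_rho_zero
  rw [x_eq, disp_elt]
  decide +kernel

theorem x'_not_mem_Adm : x' ∉ Adm base (rho 5) := by
  refine not_mem_Adm closed_five ?_ isMinuscule_rho_five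
  rw [x', disp_elt]
  decide +kernel

theorem x_mem_Perm : x ∈ Perm base (rho 0) := by
  rw [x_eq]
  refine elt_mem_Perm _ _ [0, 2, 3, 1, 4, 3, 2, 0, 5, 4, 3, 1, 2, 3, 4, 5]
    ![[[0]],
      [[1, 3, 4, 5, 0, 2, 3, 4, 1, 3, 2, 0], []],
      [[0], [3, 4, 5, 2, 3, 4, 1, 3, 2, 0]],
      [[3, 4, 1, 3, 2, 0], [5, 3, 4, 1, 3, 2, 0], [4, 5, 3, 4, 1, 3, 2, 0]],
      [[3, 4, 1, 3, 2, 0], [4, 5, 3, 4, 1, 3, 2, 0]],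
      [[5, 3, 4, 1, 3, 2, 0]]] ?_ ?_ ?_
  all_goals decide +kernel

theorem x'_mem_Perm : x' ∈ Perm base (rho 5) := by
  refine elt_mem_Perm _ _ [5, 4, 3, 1, 2, 3, 4, 5, 0, 2, 3, 1, 4, 3, 2, 0]
    ![[[0, 3, 2, 1, 3, 4, 5]],
      [[1, 3, 2, 0, 5, 4, 3, 2, 1, 3, 4, 5], []],
      [[3, 2, 1, 3, 4, 5], [2, 0, 3, 2, 1, 3, 4, 5]],
      [[3, 2, 1, 3, 4, 5], [0, 3, 2, 1, 3, 4, 5], [2, 0, 3, 2, 1, 3, 4, 5]],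
      [[5], [3, 2, 0, 4, 3, 2, 1, 3, 4, 5]],
      [[5]]] ?_ ?_ ?_
  all_goals decide +kernel

theorem Adm_ne_Perm_rho_zero : Adm base (rho 0) ≠ Perm base (rho 0) := fun h =>
  x_not_mem_Adm (h ▸ x_mem_Perm)

theorem Adm_ne_Perm_rho_five : Adm base (rho 5) ≠ Perm base (rho 5) := fun h =>
  x'_not_mem_Adm (h ▸ x'_mem_Perm)

/-! ### Minuscule coweights -/

theorem minuscule_dominant_iff (μ : L) :
    (IsMinuscule datum μ ∧ IsDominant base μ ∧ μ ≠ 0) ↔ (μ = rho 0 ∨ μ = rho 5) := by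
  constructor
  · rintro ⟨hm, hd, h0⟩
    have hd' : ∀ i, 0 ≤ μ i := fun i => by
      have : simple i ∈ (base.support : Set Idx) := by rw [support_base]; exact ⟨i, rfl⟩
      have h := hd (simple i) this
      rw [root'_apply] at h
      simpa [simple] using h
    -- For a dominant minuscule coweight the pairing with the highest root is at most `1`.
    -- Coordinates with coefficient `2` or `3` must vanish, leaving room for a single `1` at an end
    -- with coefficient `1`.
    have ht := hm theta
    have e : datum.root' theta μ = μ 0 + 2 * μ 1 + 2 * μ 2 + 3 * μ 3 + 2 * μ 4 + μ 5 := by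
      rw [root'_apply]
      simp [theta, dotProduct, Fin.sum_univ_succ]
      ring
    rw [e] at ht
    have := hd' 0; have := hd' 1; have := hd' 2; have := hd' 3; have := hd' 4; have := hd' 5
    have h1 : μ 1 = 0 := by lia
    have h2 : μ 2 = 0 := by lia
    have h3 : μ 3 = 0 := by lia
    have h4 : μ 4 = 0 := by lia
    have h05 : (μ 0 = 0 ∧ μ 5 = 0) ∨ (μ 0 = 1 ∧ μ 5 = 0) ∨ (μ 0 = 0 ∧ μ 5 = 1) := by lia
    rcases h05 with ⟨ha, hb⟩ | ⟨ha, hb⟩ | ⟨ha, hb⟩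
    · exfalso
      apply h0
      ext i
      fin_cases i <;> assumption
    · left
      ext i
      fin_cases i <;> assumption
    · right
      ext i
      fin_cases i <;> assumption
  · have hdom : ∀ j, IsDominant base (rho j) := by
      intro j i hi
      have hi' : i ∈ Set.range simple := by rw [← support_base]; exact hi
      obtain ⟨i, rfl⟩ := hi'
      rw [root_rho]
      split <;> simp
    rintro (rfl | rfl)
    · exact ⟨isMinuscule_rho_zero, hdom _, by decide⟩
    · exact ⟨isMinuscule_rho_five, hdom _, by decide⟩

/-- A coweight with bounded coordinates becomes dominant by repeatedly reflecting in simple roots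
at which it is negative. -/
theorem exists_dominant (N : ℕ) : ∀ μ : L, IsMinuscule datum μ →
    160 - (16 * μ 0 + 22 * μ 1 + 30 * μ 2 + 42 * μ 3 + 30 * μ 4 + 16 * μ 5) ≤ N →
    ∃ w : W datum, IsDominant base ((w : L ≃ₗ[ℤ] L) μ) := by
  have bound : ∀ μ : L, IsMinuscule datum μ → ∀ i, -1 ≤ μ i ∧ μ i ≤ 1 := fun μ h i => by
    have := h (simple i)
    rw [root'_apply] at this
    have e : (simple i).1 ⬝ᵥ μ = μ i := by simp [simple]
    lia
  induction N with
  | zero =>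
    intro μ h h'
    have hb := bound μ h
    have := hb 0; have := hb 1; have := hb 2; have := hb 3; have := hb 4; have := hb 5
    simp only [Nat.cast_zero] at h'
    lia
  | succ N ih =>
    intro μ h h'
    by_cases hd : ∀ i, 0 ≤ μ i
    · refine ⟨1, fun i hi => ?_⟩
      have hi' : i ∈ Set.range simple := by rw [← support_base]; exact hi
      obtain ⟨i, rfl⟩ := hi'
      rw [root'_apply]
      change 0 ≤ (simple i).1 ⬝ᵥ μ
      simpa [simple] using hd i
    · push Not at hd
      obtain ⟨i, hi⟩ := hd
      obtain ⟨w, hw⟩ := ih _ (IsMinuscule.smul h (s i)) (by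
        rw [s_apply]
        push_cast at h'
        generalize hc : μ i = c at hi
        simp only [Pi.sub_apply, Pi.smul_apply, smul_eq_mul]
        -- The weights are the coefficients of the sum of all positive roots, which pairs to `2`
        -- with each simple coroot, so reflecting at a negative coordinate raises the weighted sum.
        -- On a minuscule coweight that sum is at most `156 < 160`, so the induction terminates.
        have e : ∀ i : Fin 6, 16 * (CartanMatrix.E₆ *ᵥ Pi.single i 1 : L) 0 +
          22 * (CartanMatrix.E₆ *ᵥ Pi.single i 1 : L) 1 +
          30 * (CartanMatrix.E₆ *ᵥ Pi.single i 1 : L) 2 +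
          42 * (CartanMatrix.E₆ *ᵥ Pi.single i 1 : L) 3 +
          30 * (CartanMatrix.E₆ *ᵥ Pi.single i 1 : L) 4 +
          16 * (CartanMatrix.E₆ *ᵥ Pi.single i 1 : L) 5 = 2 := by decide
        have := congrArg (c * ·) (e i)
        linarith)
      exact ⟨w * s i, hw⟩

/-! ### Dependence on the Weyl orbit only -/

theorem Adm_smul (w : W datum) (μ : L) :
    Adm base ((w : L ≃ₗ[ℤ] L) μ) = Adm base μ := by
  ext g
  constructor
  · rintro ⟨v, hv⟩
    exact ⟨v * w, hv⟩
  · rintro ⟨v, hv⟩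
    refine ⟨v * w⁻¹, ?_⟩
    have : ((v * w⁻¹ : W datum) : L ≃ₗ[ℤ] L) ((w : L ≃ₗ[ℤ] L) μ) = (v : L ≃ₗ[ℤ] L) μ := by
      change ((v * w⁻¹ * w : W datum) : L ≃ₗ[ℤ] L) μ = _
      rw [inv_mul_cancel_right]
    rw [this]
    exact hv

theorem hull_smul (w : W datum) (μ : L) : hull datum ((w : L ≃ₗ[ℤ] L) μ) = hull datum μ := by
  rw [hull, hull]
  congr 1
  ext z
  constructor
  · rintro ⟨v, rfl⟩
    exact ⟨v * w, rfl⟩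
  · rintro ⟨v, rfl⟩
    refine ⟨v * w⁻¹, ?_⟩
    congr 1
    change _ = ((v * w⁻¹ * w : W datum) : L ≃ₗ[ℤ] L) μ
    rw [inv_mul_cancel_right]

/-- The convex hull is unchanged, and `t_{wμ}` differs from `t_μ` by a translation in the coroot
lattice, so the `Ω`-component is unchanged too. -/
theorem Perm_smul_subset (w : W datum) (μ : L) :
    Perm base μ ⊆ Perm base ((w : L ≃ₗ[ℤ] L) μ) := by
  rintro g ⟨⟨y₁, y₂, ω, hω, h₁, h₂⟩, hg⟩
  refine ⟨⟨y₁, ⟨t datum ((w : L ≃ₗ[ℤ] L) μ) * (t datum μ)⁻¹,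
    mul_inv_mem_affineWeyl (smul_sub_mem_corootLattice w μ)⟩ * y₂, ω, hω, h₁, ?_⟩, ?_⟩
  · rw [Subgroup.coe_mul, mul_assoc, ← h₂, inv_mul_cancel_right]
  · rw [hull_smul]
    exact hg

theorem Perm_smul (w : W datum) (μ : L) :
    Perm base ((w : L ≃ₗ[ℤ] L) μ) = Perm base μ := by
  refine Set.Subset.antisymm ?_ (Perm_smul_subset w μ)
  have h := Perm_smul_subset w⁻¹ ((w : L ≃ₗ[ℤ] L) μ)
  have e : ((w⁻¹ : W datum) : L ≃ₗ[ℤ] L) ((w : L ≃ₗ[ℤ] L) μ) = μ := by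
    change ((w⁻¹ * w : W datum) : L ≃ₗ[ℤ] L) μ = μ
    rw [inv_mul_cancel]
    rfl
  rwa [e] at h

theorem Adm_ne_Perm {μ : L} (hm : IsMinuscule datum μ) (h0 : μ ≠ 0) :
    Adm base μ ≠ Perm base μ := by
  obtain ⟨w, hw⟩ := exists_dominant _ μ hm (Int.self_le_toNat _)
  rw [← Adm_smul w, ← Perm_smul w]
  have h1 : (w : L ≃ₗ[ℤ] L) μ ≠ 0 := by simpa using h0
  rcases (minuscule_dominant_iff _).1 ⟨IsMinuscule.smul hm w, hw, h1⟩ with h | h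
  · rw [h]
    exact Adm_ne_Perm_rho_zero
  · rw [h]
    exact Adm_ne_Perm_rho_five

end E6

theorem mainTheorem1 :
    (E6.x ∈ RootDatum.Perm E6.base (E6.rho 0) ∧ E6.x ∉ RootDatum.Adm E6.base (E6.rho 0)) ∧
    RootDatum.Adm E6.base (E6.rho 0) ≠ RootDatum.Perm E6.base (E6.rho 0) ∧
    RootDatum.Adm E6.base (E6.rho 5) ≠ RootDatum.Perm E6.base (E6.rho 5) ∧
    (∀ μ : E6.L, (RootDatum.IsMinuscule E6.datum μ ∧ RootDatum.IsDominant E6.base μ ∧ μ ≠ 0) ↔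
      (μ = E6.rho 0 ∨ μ = E6.rho 5)) ∧
    (∀ μ : E6.L, RootDatum.IsMinuscule E6.datum μ → μ ≠ 0 →
      RootDatum.Adm E6.base μ ≠ RootDatum.Perm E6.base μ) :=
  ⟨⟨E6.x_mem_Perm, E6.x_not_mem_Adm⟩, E6.Adm_ne_Perm_rho_zero, E6.Adm_ne_Perm_rho_five,
    E6.minuscule_dominant_iff, fun _ hm h0 => E6.Adm_ne_Perm hm h0⟩
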